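/- Operator spaces are complete, $\mathcal{CB}(E,F)$ is the space of completely bounded maps $E\to F$, and $M_n(\mathcal{CB}(E,F))=\mathcal{CB}(E,M_n(F))$. A linear map $Q:G\to E$ is a complete $1$-quotient if it is onto and the induced map $G/\ker Q\to E$ is a complete isometry. A mapping ideal $\mathcal A$ assigns to each pair of operator spaces $E,F$ a linear subspace $\mathcal A(E,F)\subseteq\mathcal{CB}(E,F)$ with an operator space matrix norm $\|\cdot\|_{\mathcal A}$, such that $\mathcal A(E,F)\to\mathcal{CB}(E,F)$ is a complete contraction and, for $T\in M_n(\mathcal A(E,F))$, $r\in\mathcal{CB}(E_0,E)$, $s\in\mathcal{CB}(F,F_0)$, one has $s_n\circ T\circ r\in M_n(\mathcal A(E_0,F_0))$ with $\|s_n\circ T\circ r\|_{\mathcal A}\le\|s\|_{cb}\|T\|_{\mathcal A}\|r\|_{cb}$. It is surjective if for every complete $1$-quotient $Q:G\to E$ and every $F$: a map $T\in\mathcal{CB}(E,F)$ lies in $\mathcal A(E,F)$ whenever $TQ\in\mathcal A(G,F)$, and $\|T\|_{\mathcal A}=\|TQ\|_{\mathcal A}$ for all $T\in M_n(\mathcal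 A(E,F))$, $n\in\mathbb N$. Mapping ideals are ordered by: $\mathcal A$ is contained in $\mathcal B$ if $\mathcal A(E,F)\subseteq\mathcal B(E,F)$ with completely contractive inclusion for all $E,F$. The surjective hull $\mathcal A^{sur}$ is the smallest surjective mapping ideal that contains $\mathcal A$. **Proposition.** Every operator space $E$ admits a complete $1$-quotient map $Q_E:Z_E\to E$ from a space of the form $Z_E=\ell_1(\{S_1^{n_i}:i\in I\})$ with $n_i\geq 1$, where $S_1^{k}$ is the operator space predual of $M_k$ and $Z_E$ carries the operator space structure given by the duality $Z_E'=\ell_\infty(\{M_{n_i}\}_{i\in I})$. For every mapping ideal $\mathcal A$ the surjective hull $\mathcal A^{sur}$ exists, and for all operator spaces $E$, $F$ and every choice of such $Z_E$, $Q_E$, $$\mathcal A^{sur}(E,F)=\{T\in\mathcal{CB}(E,F): TQ_E\in\mathcal A(Z_E,F)\},$$ with $\|T\|_{M_n(\mathcal A^{sur}(E,F))}=\|TQ_E\|_{M_n(\mathcal A(Z_E,F))}$ for all $n$ and all $T\in M_n(\mathcal A^{sur}(E,F))$. -/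

import Mathlib

universe u v

noncomputable section

/-! ## Operator spaces -/

/-- The identification `M_ι(B(H)) = B(H^ι)`: an operator matrix `T` acts on the Hilbert sum `H^ι` by
`(T ξ)_i = ∑ j, T i j (ξ j)`. -/
def matOp {ι : Type} [Fintype ι] {H : Type u} [NormedAddCommGroup H] [InnerProductSpace ℂ H]
    (T : Matrix ι ι (H →L[ℂ] H)) :
    PiLp 2 (fun _ : ι => H) →L[ℂ] PiLp 2 (fun _ : ι => H) :=
  ((PiLp.continuousLinearEquiv 2 ℂ (fun _ : ι => H)).symm : (ι → H) →L[ℂ] _) ∘L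
    ContinuousLinearMap.pi (fun i => ∑ j, T i j ∘L ContinuousLinearMap.proj j) ∘L
    ((PiLp.continuousLinearEquiv 2 ℂ (fun _ : ι => H)) : _ →L[ℂ] (ι → H))

/-- An operator space matrix norm on a complex vector space `V`: a norm on each `M_n(V)` such that
`V` is, completely isometrically, a linear subspace of `B(H)` for some Hilbert space `H`, where
`M_n(B(H)) = B(H^n)`. -/
structure OpMatrixNorm (V : Type u) [AddCommGroup V] [Module ℂ V] where
  norm : ∀ n : ℕ, Matrix (Fin n) (Fin n) V → ℝ
  exists_repr : ∃ (H : Type u) (_ : NormedAddCommGroup H) (_ : InnerProductSpace ℂ H)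
    (_ : CompleteSpace H) (J : V →ₗ[ℂ] (H →L[ℂ] H)), Function.Injective J ∧
      ∀ (n : ℕ) (x : Matrix (Fin n) (Fin n) V), norm n x = ‖matOp (x.map J)‖

/-- A (complete) operator space: a complex Banach space with an operator space matrix norm that
induces the given norm on `E = M_1(E)`. -/
structure OpSpace : Type (u + 1) where
  carrier : Type u
  [normedAddCommGroup : NormedAddCommGroup carrier]
  [normedSpace : NormedSpace ℂ carrier]
  [completeSpace : CompleteSpace carrier]
  matNorm : OpMatrixNorm carrier
  norm_one : ∀ x : carrier, matNorm.norm 1 (Matrix.of fun _ _ => x) = ‖x‖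

instance : CoeSort OpSpace.{u} (Type u) := ⟨OpSpace.carrier⟩

instance (E : OpSpace.{u}) : NormedAddCommGroup E := E.normedAddCommGroup
instance (E : OpSpace.{u}) : NormedSpace ℂ E := E.normedSpace
instance (E : OpSpace.{u}) : CompleteSpace E := E.completeSpace

/-- The norm of `M_n(E)`. -/
def OpSpace.mnorm (E : OpSpace.{u}) {n : ℕ} (x : Matrix (Fin n) (Fin n) E) : ℝ :=
  E.matNorm.norm n x

/-! ## Completely bounded maps -/

section CB

variable {E F G : OpSpace.{u}}

/-- `T` is completely bounded: its amplifications `T_n : M_n(E) → M_n(F)` are uniformly bounded. -/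
def IsCB (T : E →ₗ[ℂ] F) : Prop :=
  ∃ C : ℝ, ∀ (n : ℕ) (x : Matrix (Fin n) (Fin n) E), F.mnorm (x.map T) ≤ C * E.mnorm x

/-- The completely bounded norm (of a completely bounded map). -/
def cbNorm (T : E →ₗ[ℂ] F) : ℝ :=
  sInf {C : ℝ | 0 ≤ C ∧
    ∀ (n : ℕ) (x : Matrix (Fin n) (Fin n) E), F.mnorm (x.map T) ≤ C * E.mnorm x}

/-- For a matrix `T` of maps `E → F` and `x ∈ M_m(E)`, the matrix
`(T i j (x k l)) ∈ M_m(M_n(F)) = M_{nm}(F)`, with rows `(i, k)` and columns `(j, l)`. -/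
def matApply {n m : ℕ} (T : Matrix (Fin n) (Fin n) (E →ₗ[ℂ] F)) (x : Matrix (Fin m) (Fin m) E) :
    Matrix (Fin (n * m)) (Fin (n * m)) F :=
  Matrix.reindex finProdFinEquiv finProdFinEquiv
    (Matrix.of fun (p q : Fin n × Fin m) => T p.1 q.1 (x p.2 q.2))

/-- The norm of `M_n(CB(E,F)) = CB(E, M_n(F))` (at matrices of completely bounded maps). -/
def cbMatNorm {n : ℕ} (T : Matrix (Fin n) (Fin n) (E →ₗ[ℂ] F)) : ℝ :=
  sInf {C : ℝ | 0 ≤ C ∧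
    ∀ (m : ℕ) (x : Matrix (Fin m) (Fin m) E), F.mnorm (matApply T x) ≤ C * E.mnorm x}

/-- `Q : G → E` is a complete 1-quotient: it is onto and `G / ker Q → E` is a complete isometry,
where the norm of `M_n(G / ker Q) = M_n(G) / M_n(ker Q)` is the quotient norm. -/
def IsCompleteQuotient (Q : G →ₗ[ℂ] E) : Prop :=
  Function.Surjective Q ∧ ∀ (n : ℕ) (x : Matrix (Fin n) (Fin n) E),
    E.mnorm x = sInf {c : ℝ | ∃ z : Matrix (Fin n) (Fin n) G, z.map Q = x ∧ c = G.mnorm z}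

end CB

/-! ## Mapping ideals -/

/-- A mapping ideal: a linear space `𝒜(E,F) ⊆ CB(E,F)` with an operator space matrix norm, for all
operator spaces `E`, `F`, such that `𝒜(E,F) → CB(E,F)` is a complete contraction and
`‖s_n ∘ T ∘ r‖ ≤ ‖s‖_cb ‖T‖ ‖r‖_cb` for `T ∈ M_n(𝒜(E,F))` and completely bounded `s`, `r`. -/
structure MappingIdeal : Type (u + 1) where
  space : ∀ E F : OpSpace.{u}, Submodule ℂ (E →ₗ[ℂ] F)
  matNorm : ∀ E F : OpSpace.{u}, OpMatrixNorm (space E F)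
  isCB_of_mem : ∀ {E F : OpSpace.{u}} {T : E →ₗ[ℂ] F}, T ∈ space E F → IsCB T
  cbMatNorm_le : ∀ {E F : OpSpace.{u}} {n : ℕ} (T : Matrix (Fin n) (Fin n) (space E F)),
    cbMatNorm (T.map fun t => (t : E →ₗ[ℂ] F)) ≤ (matNorm E F).norm n T
  comp_mem : ∀ {E₀ E F F₀ : OpSpace.{u}} {s : F →ₗ[ℂ] F₀} {T : E →ₗ[ℂ] F} {r : E₀ →ₗ[ℂ] E},
    IsCB s → T ∈ space E F → IsCB r → s ∘ₗ T ∘ₗ r ∈ space E₀ F₀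
  norm_comp_le : ∀ {E₀ E F F₀ : OpSpace.{u}} {s : F →ₗ[ℂ] F₀} {r : E₀ →ₗ[ℂ] E} {n : ℕ}
    (hs : IsCB s) (T : Matrix (Fin n) (Fin n) (space E F)) (hr : IsCB r),
    (matNorm E₀ F₀).norm n
        (Matrix.of fun i j => ⟨s ∘ₗ (T i j).1 ∘ₗ r, comp_mem hs (T i j).2 hr⟩)
      ≤ cbNorm s * (matNorm E F).norm n T * cbNorm r

namespace MappingIdeal

/-- The norm of `M_n(𝒜(E,F))`, for a matrix of maps with entries in `𝒜(E,F)`. -/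
def mnorm (A : MappingIdeal.{u}) {E F : OpSpace.{u}} {n : ℕ}
    (T : Matrix (Fin n) (Fin n) (E →ₗ[ℂ] F)) (hT : ∀ i j, T i j ∈ A.space E F) : ℝ :=
  (A.matNorm E F).norm n (Matrix.of fun i j => ⟨T i j, hT i j⟩)

/-- `𝒜` is surjective: for every complete 1-quotient `Q : G → E`, a map `T ∈ CB(E,F)` belongs to
`𝒜(E,F)` whenever `TQ ∈ 𝒜(G,F)`, and `‖T‖ = ‖TQ‖` for matrices `T` over `𝒜(E,F)`. -/
def IsSurjective (A : MappingIdeal.{u}) : Prop :=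
  ∀ (G E F : OpSpace.{u}) (Q : G →ₗ[ℂ] E), IsCompleteQuotient Q →
    (∀ T : E →ₗ[ℂ] F, IsCB T → T ∘ₗ Q ∈ A.space G F → T ∈ A.space E F) ∧
    ∀ (n : ℕ) (T : Matrix (Fin n) (Fin n) (E →ₗ[ℂ] F)) (hT : ∀ i j, T i j ∈ A.space E F)
      (hTQ : ∀ i j, (T.map fun t => t ∘ₗ Q) i j ∈ A.space G F),
      A.mnorm T hT = A.mnorm (T.map fun t => t ∘ₗ Q) hTQ

/-- `𝒜` is contained in `ℬ` as a mapping ideal: `𝒜(E,F) ⊆ ℬ(E,F)`, and the inclusion is a complete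
contraction, for all `E`, `F`. -/
def Contained (A B : MappingIdeal.{u}) : Prop :=
  ∀ E F : OpSpace.{u}, (∀ T : E →ₗ[ℂ] F, T ∈ A.space E F → T ∈ B.space E F) ∧
    ∀ (n : ℕ) (T : Matrix (Fin n) (Fin n) (E →ₗ[ℂ] F)) (hA : ∀ i j, T i j ∈ A.space E F)
      (hB : ∀ i j, T i j ∈ B.space E F), B.mnorm T hB ≤ A.mnorm T hA

/-- `ℋ` is the surjective hull of `𝒜`: the smallest surjective mapping ideal that contains `𝒜`. -/
def IsSurjectiveHull (A H : MappingIdeal.{u}) : Prop :=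
  H.IsSurjective ∧ A.Contained H ∧
    ∀ B : MappingIdeal.{u}, B.IsSurjective → A.Contained B → H.Contained B

end MappingIdeal

/-! ## Auxiliary facts about operator matrices -/

section MatOp

variable {ι : Type} [Fintype ι] {H : Type u} [NormedAddCommGroup H] [InnerProductSpace ℂ H]

theorem matOp_apply (T : Matrix ι ι (H →L[ℂ] H)) (ξ : PiLp 2 (fun _ : ι => H)) (i : ι) :
    matOp T ξ i = ∑ j, T i j (ξ j) := by
  simp [matOp]

theorem norm_entry_le_matOp (T : Matrix ι ι (H →L[ℂ] H)) (i j : ι) : ‖T i j‖ ≤ ‖matOp T‖ := by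
  classical
  refine ContinuousLinearMap.opNorm_le_bound _ (norm_nonneg (matOp T)) fun x => ?_
  have h1 : T i j x = matOp T (PiLp.single 2 j x) i := by
    rw [matOp_apply, Finset.sum_eq_single j]
    · simp
    · intro b _ hb; simp [hb]
    · simp
  rw [h1]
  refine (PiLp.norm_apply_le _ i).trans ((ContinuousLinearMap.le_opNorm _ _).trans ?_)
  simp

theorem norm_matOp_le_sum (T : Matrix ι ι (H →L[ℂ] H)) : ‖matOp T‖ ≤ ∑ i, ∑ j, ‖T i j‖ := by
  classical
  refine ContinuousLinearMap.opNorm_le_bound _ (by positivity) fun ξ => ?_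
  have h : matOp T ξ = ∑ i, PiLp.single 2 i (matOp T ξ i) := by
    ext k
    simp
  rw [h, Finset.sum_mul]
  refine (norm_sum_le _ _).trans (Finset.sum_le_sum fun i _ => ?_)
  rw [PiLp.norm_single, matOp_apply, Finset.sum_mul]
  refine (norm_sum_le _ _).trans (Finset.sum_le_sum fun j _ => ?_)
  exact ((T i j).le_opNorm _).trans
    (mul_le_mul_of_nonneg_left (PiLp.norm_apply_le _ j) (norm_nonneg _))

theorem norm_matOp_one (S : H →L[ℂ] H) :
    ‖matOp (Matrix.of fun _ _ : Fin 1 => S)‖ = ‖S‖ := by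
  refine le_antisymm ?_ (norm_entry_le_matOp (Matrix.of fun _ _ : Fin 1 => S) 0 0)
  simpa using norm_matOp_le_sum (Matrix.of fun _ _ : Fin 1 => S)

theorem norm_compress_le (T : Matrix ι ι (H →L[ℂ] H)) (η ξ : EuclideanSpace ℂ ι) :
    ‖∑ s, ∑ t, (starRingEnd ℂ (η s) * ξ t) • T s t‖ ≤ ‖η‖ * ‖ξ‖ * ‖matOp T‖ := by
  have key : ∀ (ζ : EuclideanSpace ℂ ι) (x : H),
      ‖(WithLp.toLp 2 (fun t => ζ t • x) : PiLp 2 (fun _ : ι => H))‖ = ‖ζ‖ * ‖x‖ := by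
    intro ζ x
    rw [← sq_eq_sq₀ (norm_nonneg _) (by positivity), mul_pow, PiLp.norm_sq_eq_of_L2,
      EuclideanSpace.norm_sq_eq, Finset.sum_mul]
    simp [norm_smul, mul_pow]
  refine ContinuousLinearMap.opNorm_le_bound _ (by positivity) fun x => ?_
  set v := (∑ s, ∑ t, (starRingEnd ℂ (η s) * ξ t) • T s t) x with hv
  have h1 : inner ℂ v v = inner ℂ (WithLp.toLp 2 (fun s => η s • v) : PiLp 2 (fun _ : ι => H))
      (matOp T (WithLp.toLp 2 (fun t => ξ t • x))) := by
    rw [PiLp.inner_apply]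
    simp only [matOp_apply, inner_smul_left, inner_sum, map_smul, inner_smul_right]
    have e : v = ∑ s, ∑ t, (starRingEnd ℂ (η s) * ξ t) • T s t x := by
      rw [hv]; simp only [sum_apply, smul_apply]
    calc inner ℂ v v = inner ℂ v (∑ s, ∑ t, (starRingEnd ℂ (η s) * ξ t) • T s t x) := by rw [← e]
      _ = _ := by
        simp only [inner_sum, inner_smul_right]
        exact Finset.sum_congr rfl fun s _ => Finset.sum_congr rfl fun t _ => by ring
  have h2 : ‖v‖ ^ 2 ≤ (‖η‖ * ‖v‖) * (‖matOp T‖ * (‖ξ‖ * ‖x‖)) := by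
    calc ‖v‖ ^ 2 = ‖inner ℂ v v‖ := by rw [inner_self_eq_norm_sq_to_K]; simp
      _ ≤ _ := by
        rw [h1, ← key η v, ← key ξ x]
        exact (norm_inner_le_norm _ _).trans
          (mul_le_mul_of_nonneg_left (ContinuousLinearMap.le_opNorm _ _) (norm_nonneg _))
  rcases (norm_nonneg v).eq_or_lt with h0 | h0
  · rw [← h0]; positivity
  · refine le_of_mul_le_mul_left ?_ h0
    nlinarith [h2]

end MatOp

/-! A direct sum of representations. -/

theorem lp_two_hasSum {𝒴 : Type u} {K : 𝒴 → Type v} [∀ j, NormedAddCommGroup (K j)] (f : lp K 2) :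
    HasSum (fun j => ‖f j‖ ^ 2) (‖f‖ ^ 2) := by
  have h := lp.hasSum_norm (p := 2) (by norm_num) f
  simpa using h

section Family

variable {𝒴 : Type u} {K : 𝒴 → Type v} [∀ j, NormedAddCommGroup (K j)]
  [∀ j, InnerProductSpace ℂ (K j)]

theorem norm_blocks_le {φ : ∀ j, K j →L[ℂ] K j} {C : ℝ} (hC : ∀ j, ‖φ j‖ ≤ C) (f : lp K 2)
    (j : 𝒴) : ‖φ j (f j)‖ ≤ ‖((C : ℂ) • f) j‖ := by
  rw [lp.coeFn_smul, Pi.smul_apply, norm_smul]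
  refine ((φ j).le_opNorm _).trans (mul_le_mul_of_nonneg_right ((hC j).trans ?_) (norm_nonneg _))
  simpa using le_abs_self C

/-- The block diagonal operator with uniformly bounded blocks. -/
def diagOp (φ : ∀ j, K j →L[ℂ] K j) (C : ℝ) (hC : ∀ j, ‖φ j‖ ≤ C) : lp K 2 →L[ℂ] lp K 2 :=
  LinearMap.mkContinuous
    { toFun := fun f => ⟨fun j => φ j (f j), (lp.memℓp ((C : ℂ) • f)).mono' (norm_blocks_le hC f)⟩
      map_add' := fun f g => by ext j; simp; rfl
      map_smul' := fun c f => by ext j; simp } |C| fun f => by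
    refine (lp.norm_mono two_ne_zero (y := (C : ℂ) • f) (norm_blocks_le hC f)).trans ?_
    rw [lp.norm_const_smul two_ne_zero]
    simp

theorem diagOp_apply (φ : ∀ j, K j →L[ℂ] K j) (C : ℝ) (hC : ∀ j, ‖φ j‖ ≤ C) (f : lp K 2) (j : 𝒴) :
    diagOp φ C hC f j = φ j (f j) := rfl

theorem norm_matOp_diag {ι : Type} [Fintype ι] [Nonempty 𝒴]
    (T : Matrix ι ι (lp K 2 →L[ℂ] lp K 2)) (S : ∀ j, Matrix ι ι (K j →L[ℂ] K j))
    (h : ∀ k l f j, T k l f j = S j k l (f j)) :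
    ‖matOp T‖ = ⨆ j, ‖matOp (S j)‖ := by
  classical
  have hap : ∀ (ξ : PiLp 2 (fun _ : ι => lp K 2)) (k : ι) (j : 𝒴),
      matOp T ξ k j = matOp (S j) (WithLp.toLp 2 fun l => ξ l j) k := by
    intro ξ k j
    rw [matOp_apply, matOp_apply, lp.coeFn_sum, Finset.sum_apply]
    simp only [h]
  have hns : ∀ (ξ : PiLp 2 (fun _ : ι => lp K 2)),
      HasSum (fun j => ‖(WithLp.toLp 2 fun l => ξ l j : PiLp 2 (fun _ : ι => K j))‖ ^ 2)
        (‖ξ‖ ^ 2) := by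
    intro ξ
    simp only [PiLp.norm_sq_eq_of_L2]
    exact hasSum_sum fun l _ => lp_two_hasSum (ξ l)
  have hmt : ∀ (ξ : PiLp 2 (fun _ : ι => lp K 2)) (j : 𝒴),
      (WithLp.toLp 2 fun l => matOp T ξ l j : PiLp 2 (fun _ : ι => K j))
        = matOp (S j) (WithLp.toLp 2 fun l => ξ l j) := by
    intro ξ j
    ext k
    exact hap ξ k j
  have hle : ∀ j, ‖matOp (S j)‖ ≤ ‖matOp T‖ := by
    intro j
    refine ContinuousLinearMap.opNorm_le_bound _ (norm_nonneg (matOp T)) fun ζ => ?_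
    set ξ : PiLp 2 (fun _ : ι => lp K 2) := WithLp.toLp 2 fun l => lp.single 2 j (ζ l) with hξ
    have e1 : (WithLp.toLp 2 fun l => ξ l j : PiLp 2 (fun _ : ι => K j)) = ζ := by
      ext l
      simp [hξ]
    have e2 : ‖ξ‖ = ‖ζ‖ := by
      rw [← sq_eq_sq₀ (norm_nonneg _) (norm_nonneg _), PiLp.norm_sq_eq_of_L2,
        PiLp.norm_sq_eq_of_L2]
      refine Finset.sum_congr rfl fun l _ => ?_
      rw [hξ, lp.norm_single (by norm_num)]
    have e3 : ‖matOp (S j) ζ‖ ^ 2 ≤ ‖matOp T ξ‖ ^ 2 := by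
      have := le_hasSum (hns (matOp T ξ)) j fun _ _ => sq_nonneg _
      rwa [hmt, e1] at this
    rw [← e2]
    exact (le_of_sq_le_sq e3 (norm_nonneg _)).trans (ContinuousLinearMap.le_opNorm _ _)
  have hbdd : BddAbove (Set.range fun j => ‖matOp (S j)‖) :=
    ⟨‖matOp T‖, by rintro _ ⟨j, rfl⟩; exact hle j⟩
  refine le_antisymm ?_ (ciSup_le hle)
  set C := ⨆ j, ‖matOp (S j)‖ with hCdef
  have hC0 : 0 ≤ C := (norm_nonneg (matOp (S (Classical.arbitrary 𝒴)))).trans (le_ciSup hbdd _)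
  refine ContinuousLinearMap.opNorm_le_bound _ hC0 fun ξ => ?_
  refine le_of_sq_le_sq ?_ (by positivity)
  rw [mul_pow]
  refine hasSum_le (fun j => ?_) (hns (matOp T ξ)) ((hns ξ).mul_left (C ^ 2))
  rw [hmt, ← mul_pow]
  refine pow_le_pow_left₀ (norm_nonneg _) ?_ 2
  exact (ContinuousLinearMap.le_opNorm _ _).trans
    (mul_le_mul_of_nonneg_right (le_ciSup hbdd j) (norm_nonneg _))

end Family

/-- A separating family of representations, with the supremum of the matrix norms, gives an
operator space matrix norm. -/
theorem exists_repr_of_family {V : Type u} [AddCommGroup V] [Module ℂ V] {𝒴 : Type u} [Nonempty 𝒴]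
    {K : 𝒴 → Type} [∀ j, NormedAddCommGroup (K j)] [∀ j, InnerProductSpace ℂ (K j)]
    [∀ j, CompleteSpace (K j)] (φ : ∀ j, V → (K j →L[ℂ] K j))
    (hadd : ∀ j v w, φ j (v + w) = φ j v + φ j w) (hsmul : ∀ j (c : ℂ) v, φ j (c • v) = c • φ j v)
    (C : V → ℝ) (hC : ∀ v j, ‖φ j v‖ ≤ C v) (hsep : ∀ v, (∀ j, φ j v = 0) → v = 0) :
    ∃ (H : Type u) (_ : NormedAddCommGroup H) (_ : InnerProductSpace ℂ H)
      (_ : CompleteSpace H) (J : V →ₗ[ℂ] (H →L[ℂ] H)), Function.Injective J ∧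
      ∀ (n : ℕ) (x : Matrix (Fin n) (Fin n) V), (⨆ j, ‖matOp (x.map (φ j))‖) = ‖matOp (x.map J)‖ := by
  classical
  refine ⟨lp K 2, inferInstance, inferInstance, inferInstance,
    { toFun := fun v => diagOp (fun j => φ j v) (C v) (hC v)
      map_add' := fun v w => by
        ext f j
        simp [diagOp_apply, hadd]
      map_smul' := fun c v => by
        ext f j
        simp [diagOp_apply, hsmul] }, ?_, ?_⟩
  · rw [injective_iff_map_eq_zero]
    intro v hv
    refine hsep v fun j => ?_
    ext x
    have := congrArg (fun g : lp K 2 => g j) (DFunLike.congr_fun hv (lp.single 2 j x))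
    simpa [diagOp_apply] using this
  · intro n x
    exact (norm_matOp_diag _ (fun j => x.map (φ j)) fun k l f j => rfl).symm

/-! ## The trace class `S_1^k` and the sums `ℓ_1({S_1^{n_i}})` -/

/-- `M_k = B(ℓ_2^k)`, with the operator norm. -/
abbrev Mat (k : ℕ) : Type := EuclideanSpace ℂ (Fin k) →L[ℂ] EuclideanSpace ℂ (Fin k)

/-- The entry of `T ∈ M_k` in row `a` and column `b`. -/
def Mat.entry {k : ℕ} (T : Mat k) (a b : Fin k) : ℂ := T (EuclideanSpace.single b 1) a

/-- The space `S_1^k` of `k × k` matrices. -/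
def S1 (k : ℕ) : Type := Matrix (Fin k) (Fin k) ℂ

instance (k : ℕ) : AddCommGroup (S1 k) := inferInstanceAs (AddCommGroup (Matrix (Fin k) (Fin k) ℂ))
instance (k : ℕ) : Module ℂ (S1 k) := inferInstanceAs (Module ℂ (Matrix (Fin k) (Fin k) ℂ))
instance (k : ℕ) : FiniteDimensional ℂ (S1 k) :=
  inferInstanceAs (FiniteDimensional ℂ (Matrix (Fin k) (Fin k) ℂ))

/-- The duality `⟨a, T⟩ = ∑ a_{ij} T_{ij}` between `S_1^k` and `M_k`. -/
def S1.pairing (k : ℕ) : S1 k →ₗ[ℂ] StrongDual ℂ (Mat k) where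
  toFun a := LinearMap.toContinuousLinearMap
    { toFun := fun T => ∑ i : Fin k, ∑ j : Fin k, (show Matrix _ _ ℂ from a) i j * T.entry i j
      map_add' := fun S T => by
        simp [Mat.entry, mul_add, Finset.sum_add_distrib]
      map_smul' := fun c T => by
        simp only [Mat.entry, Finset.smul_sum, RingHom.id_apply]
        refine Finset.sum_congr rfl fun i _ => Finset.sum_congr rfl fun j _ => ?_
        simp; ring }
  map_add' a b := by
    ext T
    simp only [LinearMap.coe_toContinuousLinearMap', LinearMap.coe_mk, AddHom.coe_mk,
      add_apply, ← Finset.sum_add_distrib, ← add_mul]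
    rfl
  map_smul' c a := by
    ext T
    simp only [LinearMap.coe_toContinuousLinearMap', LinearMap.coe_mk, AddHom.coe_mk,
      RingHom.id_apply, smul_apply, smul_eq_mul, Finset.mul_sum, ← mul_assoc]
    rfl

theorem S1.pairing_apply {k : ℕ} (a : S1 k) (T : Mat k) :
    S1.pairing k a T = ∑ i : Fin k, ∑ j : Fin k, (show Matrix _ _ ℂ from a) i j * T.entry i j :=
  rfl

theorem S1.pairing_injective (k : ℕ) : Function.Injective (S1.pairing k) := by
  rw [injective_iff_map_eq_zero]
  intro a ha
  refine Matrix.ext fun i j => ?_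
  have h := DFunLike.congr_fun ha
    (Matrix.toEuclideanCLM (n := Fin k) (𝕜 := ℂ) (Matrix.single i j 1))
  rw [S1.pairing_apply] at h
  have e : ∀ p q : Fin k, Mat.entry (Matrix.toEuclideanCLM (n := Fin k) (𝕜 := ℂ)
      (Matrix.single i j 1)) p q = if p = i ∧ q = j then 1 else 0 := by
    intro p q
    simp [Mat.entry, Matrix.single_apply, eq_comm]
  simp only [e] at h
  rw [Finset.sum_eq_single i, Finset.sum_eq_single j] at h
  · simp only [and_self, if_true, mul_one] at h
    exact h
  · intro b _ hb; simp [hb]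
  · simp
  · intro b _ hb; simp [hb]
  · simp

/-- `S_1^k` carries the trace norm `‖a‖ = sup {|⟨a, T⟩| : T ∈ M_k, ‖T‖ ≤ 1}`. -/
instance (k : ℕ) : NormedAddCommGroup (S1 k) :=
  NormedAddCommGroup.induced (S1 k) (StrongDual ℂ (Mat k)) (S1.pairing k) (S1.pairing_injective k)

instance (k : ℕ) : NormedSpace ℂ (S1 k) :=
  NormedSpace.induced ℂ (S1 k) (StrongDual ℂ (Mat k)) (S1.pairing k)

instance (k : ℕ) : CompleteSpace (S1 k) := FiniteDimensional.complete ℂ (S1 k)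

theorem S1.norm_def {k : ℕ} (a : S1 k) : ‖a‖ = ‖S1.pairing k a‖ := rfl

section L1Sum

variable {I : Type u} (n : I → ℕ)

/-- The unit ball of `M_r(ℓ_∞({M_{n_i}}))`. -/
def UnitBall (r : ℕ) : Type u :=
  {y : ∀ i, Matrix (Fin r) (Fin r) (Mat (n i)) // ∀ i, ‖matOp (y i)‖ ≤ 1}

/-- For `z ∈ ℓ_1({S_1^{n_i}})` and `y ∈ M_r(ℓ_∞({M_{n_i}}))`, the scalar matrix
`(⟨z, y_{st}⟩)_{st} ∈ M_r`, where `⟨z, w⟩ = ∑ i, ⟨z i, w i⟩`. -/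
def pairMat {r : ℕ} (y : UnitBall n r) (z : lp (fun i => S1 (n i)) 1) : Mat r :=
  Matrix.toEuclideanCLM (n := Fin r) (𝕜 := ℂ)
    (Matrix.of fun s t => ∑' i, S1.pairing (n i) (z i) (y.1 i s t))

/-- The norm of `M_m(ℓ_1({S_1^{n_i}}))`, by duality with `ℓ_1({S_1^{n_i}})' = ℓ_∞({M_{n_i}})`:
`‖z‖ = sup {‖(⟨z_{kl}, y_{st}⟩)‖_{M_m(M_r)} : r ∈ ℕ, y ∈ M_r(ℓ_∞({M_{n_i}})), ‖y‖ ≤ 1}`. -/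
def l1MatNorm (m : ℕ) (z : Matrix (Fin m) (Fin m) (lp (fun i => S1 (n i)) 1)) : ℝ :=
  ⨆ j : Σ r : ℕ, UnitBall n r, ‖matOp (z.map (pairMat n j.2))‖


theorem S1.norm_pairing_le {k : ℕ} (a : S1 k) (T : Mat k) : ‖S1.pairing k a T‖ ≤ ‖a‖ * ‖T‖ :=
  (S1.pairing k a).le_opNorm T

theorem l1_hasSum (z : lp (fun i => S1 (n i)) 1) : HasSum (fun i => ‖z i‖) ‖z‖ := by
  have h := lp.hasSum_norm (p := 1) (by norm_num) z
  simpa using h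

theorem UnitBall.norm_entry_le {n : I → ℕ} {r : ℕ} (y : UnitBall n r) (i : I) (s t : Fin r) :
    ‖y.1 i s t‖ ≤ 1 :=
  (norm_entry_le_matOp _ s t).trans (y.2 i)

theorem summable_pairing {n : I → ℕ} {r : ℕ} (y : UnitBall n r) (z : lp (fun i => S1 (n i)) 1) (s t : Fin r) :
    Summable fun i => S1.pairing (n i) (z i) (y.1 i s t) :=
  Summable.of_norm_bounded (l1_hasSum n z).summable fun i =>
    (S1.norm_pairing_le _ _).trans (mul_le_of_le_one_right (norm_nonneg _) (y.norm_entry_le i s t))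

theorem pairMat_add {r : ℕ} (y : UnitBall n r) (z w : lp (fun i => S1 (n i)) 1) :
    pairMat n y (z + w) = pairMat n y z + pairMat n y w := by
  rw [pairMat, pairMat, pairMat, ← map_add]
  congr 1
  ext s t
  simp only [Matrix.of_apply, Matrix.add_apply]
  rw [← (summable_pairing y z s t).tsum_add (summable_pairing y w s t)]
  simp

theorem pairMat_smul {r : ℕ} (y : UnitBall n r) (c : ℂ) (z : lp (fun i => S1 (n i)) 1) :
    pairMat n y (c • z) = c • pairMat n y z := by
  rw [pairMat, pairMat, ← map_smul]
  congr 1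
  ext s t
  simp only [Matrix.of_apply, Matrix.smul_apply]
  rw [smul_eq_mul, ← tsum_mul_left]
  simp

theorem norm_pairMat_le {r : ℕ} (y : UnitBall n r) (z : lp (fun i => S1 (n i)) 1) :
    ‖pairMat n y z‖ ≤ ‖z‖ := by
  refine ContinuousLinearMap.opNorm_le_of_re_inner_le (norm_nonneg z) fun ξ η hξ hη => ?_
  set W : ∀ i, Mat (n i) := fun i =>
    ∑ s, ∑ t, (starRingEnd ℂ (η s) * ξ t) • y.1 i s t with hW
  have hWn : ∀ i, ‖W i‖ ≤ 1 := fun i => by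
    have := norm_compress_le (y.1 i) η ξ
    rw [hξ, hη, one_mul, one_mul] at this
    exact this.trans (y.2 i)
  have hsum : HasSum (fun i => S1.pairing (n i) (z i) (W i))
      (∑ s, ∑ t, (starRingEnd ℂ (η s) * ξ t) * ∑' i, S1.pairing (n i) (z i) (y.1 i s t)) := by
    have : ∀ i, S1.pairing (n i) (z i) (W i) = ∑ s, ∑ t, (starRingEnd ℂ (η s) * ξ t) *
        S1.pairing (n i) (z i) (y.1 i s t) := fun i => by
      simp [hW, map_sum]
    simp only [this]
    exact hasSum_sum fun s _ => hasSum_sum fun t _ =>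
      ((summable_pairing y z s t).hasSum.mul_left _)
  have hin : inner ℂ η (pairMat n y z ξ) =
      ∑ s, ∑ t, (starRingEnd ℂ (η s) * ξ t) * ∑' i, S1.pairing (n i) (z i) (y.1 i s t) := by
    rw [PiLp.inner_apply]
    refine Finset.sum_congr rfl fun s _ => ?_
    rw [pairMat, Matrix.ofLp_toEuclideanCLM, Matrix.mulVec, dotProduct]
    simp only [Matrix.of_apply, RCLike.inner_apply, Finset.sum_mul]
    exact Finset.sum_congr rfl fun t _ => by ring
  rw [inner_re_symm, hin, ← hsum.tsum_eq]
  refine (RCLike.re_le_norm _).trans ?_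
  exact tsum_of_norm_bounded (l1_hasSum n z) fun i => (S1.norm_pairing_le _ _).trans
    (mul_le_of_le_one_right (norm_nonneg _) (hWn i))

theorem S1.exists_norming {k : ℕ} (a : S1 k) {θ : ℝ} (hθ : θ < 1) :
    ∃ T : Mat k, ‖T‖ ≤ 1 ∧ ∃ r : ℝ, θ * ‖a‖ ≤ r ∧ S1.pairing k a T = r := by
  rcases (norm_nonneg a).eq_or_lt with h0 | h0
  · exact ⟨0, by simp, 0, by simp [← h0], by simp⟩
  · obtain ⟨x, hx, hr⟩ := (S1.pairing k a).exists_lt_apply_of_lt_opNorm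
      (show θ * ‖a‖ < ‖S1.pairing k a‖ by rw [← S1.norm_def]; nlinarith)
    obtain ⟨c, hc, hc'⟩ := RCLike.exists_norm_eq_mul_self (S1.pairing k a x)
    refine ⟨c • x, ?_, ‖S1.pairing k a x‖, hr.le, ?_⟩
    · rw [norm_smul, hc, one_mul]; exact hx.le
    · rw [map_smul, smul_eq_mul, ← hc']; rfl

theorem norm_le_of_pairMat {z : lp (fun i => S1 (n i)) 1} {C : ℝ}
    (h : ∀ y : UnitBall n 1, ‖pairMat n y z‖ ≤ C) : ‖z‖ ≤ C := by
  have key : ∀ θ : ℝ, θ < 1 → θ * ‖z‖ ≤ C := by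
    intro θ hθ
    choose T hT r hr hp using fun i => S1.exists_norming (z i) hθ
    let y : UnitBall n 1 := ⟨fun i => Matrix.of fun _ _ => T i, fun i => by
      rw [norm_matOp_one]; exact hT i⟩
    have hs : HasSum (fun i => S1.pairing (n i) (z i) (T i))
      (∑' i, S1.pairing (n i) (z i) (T i)) := (summable_pairing y z 0 0).hasSum
    have hre : HasSum r (∑' i, S1.pairing (n i) (z i) (T i)).re := by
      have := Complex.hasSum_re hs
      simpa [hp] using this
    have h1 : θ * ‖z‖ ≤ (∑' i, S1.pairing (n i) (z i) (T i)).re :=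
      hasSum_le hr ((l1_hasSum n z).mul_left θ) hre
    have h2 : ‖∑' i, S1.pairing (n i) (z i) (T i)‖ ≤ ‖pairMat n y z‖ := by
      have e : pairMat n y z (EuclideanSpace.single 0 1) 0
          = ∑' i, S1.pairing (n i) (z i) (T i) := by
        rw [pairMat, Matrix.ofLp_toEuclideanCLM]
        simp [y]
      rw [← e]
      refine (PiLp.norm_apply_le _ _).trans ((ContinuousLinearMap.le_opNorm _ _).trans ?_)
      simp
    exact h1.trans ((Complex.re_le_norm _).trans (h2.trans (h y)))
  have ht : Filter.Tendsto (fun θ : ℝ => θ * ‖z‖) (nhdsWithin 1 (Set.Iio 1)) (nhds ‖z‖) := by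
    have : ContinuousAt (fun θ : ℝ => θ * ‖z‖) 1 := by fun_prop
    simpa using this.tendsto.mono_left nhdsWithin_le_nhds
  exact le_of_tendsto ht (Filter.eventually_of_mem self_mem_nhdsWithin key)

instance : Nonempty (Σ r : ℕ, UnitBall n r) :=
  ⟨⟨0, fun _ => 0, fun i => by
    refine (norm_matOp_le_sum _).trans ?_
    simp⟩⟩

/-- The operator space `ℓ_1({S_1^{n_i} : i ∈ I})`. -/
def l1S1 : OpSpace.{u} where
  carrier := lp (fun i => S1 (n i)) 1
  matNorm :=
    { norm := l1MatNorm n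
      exists_repr := exists_repr_of_family
        (𝒴 := Σ r : ℕ, UnitBall n r) (K := fun j => EuclideanSpace ℂ (Fin j.1))
        (fun j => pairMat n j.2) (fun j => pairMat_add n j.2) (fun j => pairMat_smul n j.2)
        (fun z => ‖z‖) (fun z j => norm_pairMat_le n j.2 z) fun z hz => by
          have : ‖z‖ ≤ 0 := norm_le_of_pairMat n fun y => by simp [hz ⟨1, y⟩]
          simpa using this }
  norm_one := fun z => by
    have e : ∀ j : Σ r : ℕ, UnitBall n r,
        ‖matOp ((Matrix.of fun _ _ : Fin 1 => z).map (pairMat n j.2))‖ = ‖pairMat n j.2 z‖ :=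
      fun j => norm_matOp_one (pairMat n j.2 z)
    show l1MatNorm n 1 _ = _
    simp only [l1MatNorm, e]
    refine le_antisymm (ciSup_le fun j => norm_pairMat_le n j.2 z) ?_
    exact norm_le_of_pairMat n fun y => le_ciSup
      (f := fun j : Σ r : ℕ, UnitBall n r => ‖pairMat n j.2 z‖)
      ⟨‖z‖, by rintro _ ⟨j, rfl⟩; exact norm_pairMat_le n j.2 z⟩ ⟨1, y⟩

end L1Sum

end

/-! The spaces `l1S1 n` are projective up to ε. A completely bounded map out of `l1S1 n` is the same
as a bounded family of matrices `x i` in `M_{n_i}(E)`, namely the images of the matrix units, and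
its cb norm is at most the supremum of their norms (`mnorm_l1Lift_le`); the matrix units themselves
form a matrix of norm at most 1 (`l1MatNorm_unit_le`). If `Q : G → E` is a complete quotient and `R
: l1S1 n → E`, then lifting each of these matrices to `G` with norm arbitrarily close to the
original gives `R'` with `Q R' = R` and cb norm arbitrarily close to that of `R` (`exists_l1_lift`).
Taking as family all matrices in the unit balls over `E` yields the cover `Q_E : Z_E → E`.

Declare `T` to be in the hull when `T Q_E` is in `A`, with the norm of `T Q_E`. If `T Q` is in `A`
for some complete quotient `Q` onto `E`, then `T R = (T Q) R'` is in `A` for every completely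
bounded `R : l1S1 n → E`, with norm at most `‖T Q‖ ‖R‖_cb` after the excess in `‖R'‖_cb` is let tend
to 0. This one estimate gives the ideal property (`R = r Q_{E₀}`) and the independence of the cover
(two covers in both roles). Surjectivity follows because `Q Q_G` is again a cover of `E`, and
minimality because a surjective `B` containing `A` contains `T Q_E`, hence `T`. Mutual containment
forces equal spaces and norms, so any hull has this description. -/

noncomputable section

/-! ## Compressions of operator matrices -/

section Compression

variable {H : Type u} [NormedAddCommGroup H] [InnerProductSpace ℂ H]

/-- The operator matrix `(⟨V e_s, X_{ab} V e_t⟩)_{ab}`, indexed by `s` and `t`, of the compression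
of `X ∈ M_k(B(H))` along an isometry `V : ℓ_2^r → H`. -/
def coeffMat {k r : ℕ} (V : EuclideanSpace ℂ (Fin r) →ₗᵢ[ℂ] H)
    (X : Matrix (Fin k) (Fin k) (H →L[ℂ] H)) : Matrix (Fin r) (Fin r) (Mat k) :=
  Matrix.of fun s t => Matrix.toEuclideanCLM (n := Fin k) (𝕜 := ℂ) (Matrix.of fun a b =>
    inner ℂ (V (EuclideanSpace.single s 1)) (X a b (V (EuclideanSpace.single t 1))))

theorem toEuclideanCLM_entry {k : ℕ} (M : Matrix (Fin k) (Fin k) ℂ) (a b : Fin k) :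
    Mat.entry (Matrix.toEuclideanCLM (n := Fin k) (𝕜 := ℂ) M) a b = M a b := by
  simp [Mat.entry]

theorem coeffMat_entry {k r : ℕ} (V : EuclideanSpace ℂ (Fin r) →ₗᵢ[ℂ] H)
    (X : Matrix (Fin k) (Fin k) (H →L[ℂ] H)) (s t : Fin r) (a b : Fin k) :
    (coeffMat V X s t).entry a b =
      inner ℂ (V (EuclideanSpace.single s 1)) (X a b (V (EuclideanSpace.single t 1))) :=
  toEuclideanCLM_entry _ a b

theorem map_eq_sum_single {r : ℕ} (V : EuclideanSpace ℂ (Fin r) →ₗᵢ[ℂ] H)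
    (ξ : EuclideanSpace ℂ (Fin r)) :
    V ξ = ∑ s, ξ s • V (EuclideanSpace.single s 1) := by
  conv_lhs => rw [← (EuclideanSpace.basisFun (Fin r) ℂ).sum_repr ξ]
  simp

theorem inner_matOp {ι : Type} [Fintype ι] (X : Matrix ι ι (H →L[ℂ] H))
    (η ξ : PiLp 2 (fun _ : ι => H)) :
    inner ℂ η (matOp X ξ) = ∑ a, ∑ b, inner ℂ (η a) (X a b (ξ b)) := by
  simp only [PiLp.inner_apply, matOp_apply, inner_sum]

theorem norm_le_of_inner_le {K : Type v} [NormedAddCommGroup K] [InnerProductSpace ℂ K]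
    {T : K →L[ℂ] K} {C : ℝ} (hC : 0 ≤ C)
    (h : ∀ η ξ : K, ‖inner ℂ η (T ξ)‖ ≤ C * (‖η‖ * ‖ξ‖)) : ‖T‖ ≤ C := by
  refine ContinuousLinearMap.opNorm_le_of_re_inner_le hC fun ξ η hξ hη => ?_
  rw [inner_re_symm]
  refine (RCLike.re_le_norm _).trans ((h η ξ).trans ?_)
  simp [hξ, hη]

theorem norm_inner_matOp_le {ι : Type} [Fintype ι] (X : Matrix ι ι (H →L[ℂ] H))
    (η ξ : PiLp 2 (fun _ : ι => H)) :
    ‖inner ℂ η (matOp X ξ)‖ ≤ ‖matOp X‖ * (‖η‖ * ‖ξ‖) := by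
  refine (norm_inner_le_norm _ _).trans ?_
  calc ‖η‖ * ‖matOp X ξ‖ ≤ ‖η‖ * (‖matOp X‖ * ‖ξ‖) :=
        mul_le_mul_of_nonneg_left (ContinuousLinearMap.le_opNorm _ _) (norm_nonneg _)
    _ = _ := by ring

/-- `coeffMat V X` is the compression of `X` with the roles of `M_r` and `M_k` exchanged. Exchanging
the indices of a vector and applying `V` is isometric, and it turns the sesquilinear form of
`coeffMat V X` into that of `X`. -/
theorem norm_coeffMat_le {k r : ℕ} (V : EuclideanSpace ℂ (Fin r) →ₗᵢ[ℂ] H)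
    (X : Matrix (Fin k) (Fin k) (H →L[ℂ] H)) : ‖matOp (coeffMat V X)‖ ≤ ‖matOp X‖ := by
  let flip : PiLp 2 (fun _ : Fin r => EuclideanSpace ℂ (Fin k)) → PiLp 2 (fun _ : Fin k => H) :=
    fun ζ => WithLp.toLp 2 fun a => V (WithLp.toLp 2 fun s => ζ s a)
  have hflip : ∀ ζ, ‖flip ζ‖ = ‖ζ‖ := fun ζ => by
    rw [← sq_eq_sq₀ (norm_nonneg _) (norm_nonneg _), PiLp.norm_sq_eq_of_L2, PiLp.norm_sq_eq_of_L2]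
    simp only [flip, LinearIsometry.norm_map, EuclideanSpace.norm_sq_eq]
    exact Finset.sum_comm
  refine norm_le_of_inner_le (norm_nonneg (matOp X)) fun η ξ => ?_
  have e : inner ℂ η (matOp (coeffMat V X) ξ) = inner ℂ (flip η) (matOp X (flip ξ)) := by
    rw [inner_matOp, inner_matOp]
    have e1 : ∀ a b, inner ℂ (flip η a) (X a b (flip ξ b)) = ∑ s, ∑ t,
        starRingEnd ℂ (η s a) * (inner ℂ (V (EuclideanSpace.single s 1))
          (X a b (V (EuclideanSpace.single t 1))) * ξ t b) := fun a b => by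
      simp only [flip]
      rw [map_eq_sum_single V, map_eq_sum_single V, sum_inner]
      simp only [map_sum, map_smul, inner_sum, inner_smul_left, inner_smul_right]
      refine Finset.sum_congr rfl fun s _ => Finset.sum_congr rfl fun t _ => by ring
    have e2 : ∀ s t, inner ℂ (η s) (coeffMat V X s t (ξ t)) = ∑ a, ∑ b,
        starRingEnd ℂ (η s a) * (inner ℂ (V (EuclideanSpace.single s 1))
          (X a b (V (EuclideanSpace.single t 1))) * ξ t b) := fun s t => by
      rw [PiLp.inner_apply]
      refine Finset.sum_congr rfl fun a _ => ?_
      rw [coeffMat, Matrix.of_apply, Matrix.ofLp_toEuclideanCLM, Matrix.mulVec, dotProduct]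
      simp only [Matrix.of_apply, RCLike.inner_apply, Finset.sum_mul]
      exact Finset.sum_congr rfl fun t _ => by ring
    simp only [e1, e2]
    calc _ = ∑ s, ∑ a, ∑ t, ∑ b, _ := Finset.sum_congr rfl fun s _ => Finset.sum_comm
      _ = ∑ a, ∑ s, ∑ t, ∑ b, _ := Finset.sum_comm
      _ = ∑ a, ∑ s, ∑ b, ∑ t, _ :=
        Finset.sum_congr rfl fun a _ => Finset.sum_congr rfl fun s _ => Finset.sum_comm
      _ = ∑ a, ∑ b, ∑ s, ∑ t, _ := Finset.sum_congr rfl fun a _ => Finset.sum_comm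
  rw [e, ← hflip η, ← hflip ξ]
  exact norm_inner_matOp_le _ _ _

theorem exists_isometry_range {ι : Type} [Finite ι] (v : ι → H) :
    ∃ (r : ℕ) (V : EuclideanSpace ℂ (Fin r) →ₗᵢ[ℂ] H), ∀ i, ∃ ξ, V ξ = v i := by
  let K := Submodule.span ℂ (Set.range v)
  have : FiniteDimensional ℂ K := FiniteDimensional.span_of_finite ℂ (Set.finite_range v)
  refine ⟨_, K.subtypeₗᵢ.comp (stdOrthonormalBasis ℂ K).repr.symm.toLinearIsometry, fun i =>
    ⟨(stdOrthonormalBasis ℂ K).repr ⟨v i, Submodule.subset_span ⟨i, rfl⟩⟩, ?_⟩⟩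
  simp

/-- The compression of an operator along an isometry `ℓ_2^r → H`. -/
def compressOp {r : ℕ} (V : EuclideanSpace ℂ (Fin r) →ₗᵢ[ℂ] H) (S : H →L[ℂ] H) : Mat r :=
  Matrix.toEuclideanCLM (n := Fin r) (𝕜 := ℂ) (Matrix.of fun s t =>
    inner ℂ (V (EuclideanSpace.single s 1)) (S (V (EuclideanSpace.single t 1))))

theorem inner_compressOp {r : ℕ} (V : EuclideanSpace ℂ (Fin r) →ₗᵢ[ℂ] H) (S : H →L[ℂ] H)
    (η ξ : EuclideanSpace ℂ (Fin r)) :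
    inner ℂ η (compressOp V S ξ) = inner ℂ (V η) (S (V ξ)) := by
  rw [map_eq_sum_single V η, map_eq_sum_single V ξ, sum_inner, PiLp.inner_apply]
  refine Finset.sum_congr rfl fun a _ => ?_
  rw [compressOp, Matrix.ofLp_toEuclideanCLM, Matrix.mulVec, dotProduct]
  simp only [Matrix.of_apply, RCLike.inner_apply, Finset.sum_mul, map_sum, map_smul, inner_sum,
    inner_smul_left, inner_smul_right]
  exact Finset.sum_congr rfl fun t _ => by ring

/-- Each value `⟨η, X ξ⟩` involves only the finitely many coordinates of `η` and `ξ`, which lie in a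
finite-dimensional subspace of `H`. This matches arbitrary representations with `l1MatNorm`, which
tests against the finite matrix algebras `M_r` only. -/
theorem norm_matOp_le_of_compress {m : ℕ} (X : Matrix (Fin m) (Fin m) (H →L[ℂ] H)) {C : ℝ}
    (hC : 0 ≤ C) (h : ∀ (r : ℕ) (V : EuclideanSpace ℂ (Fin r) →ₗᵢ[ℂ] H),
      ‖matOp (X.map (compressOp V))‖ ≤ C) : ‖matOp X‖ ≤ C := by
  refine norm_le_of_inner_le hC fun η ξ => ?_
  -- One isometry has to reach the coordinates of both vectors, hence the index type `Fin m ⊕ Fin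
  -- m`.
  obtain ⟨r, V, hV⟩ := exists_isometry_range (fun i : Fin m ⊕ Fin m => Sum.elim η ξ i)
  choose η' hη using fun i => hV (Sum.inl i)
  choose ξ' hξ using fun i => hV (Sum.inr i)
  simp only [Sum.elim_inl, Sum.elim_inr] at hη hξ
  have hn : ∀ (ζ : PiLp 2 (fun _ : Fin m => H)) (ζ' : Fin m → EuclideanSpace ℂ (Fin r)),
      (∀ i, V (ζ' i) = ζ i) →
        ‖(WithLp.toLp 2 ζ' : PiLp 2 (fun _ : Fin m => EuclideanSpace ℂ (Fin r)))‖ = ‖ζ‖ := by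
    intro ζ ζ' hζ
    rw [← sq_eq_sq₀ (norm_nonneg _) (norm_nonneg _), PiLp.norm_sq_eq_of_L2, PiLp.norm_sq_eq_of_L2]
    simp [← hζ]
  have e : inner ℂ η (matOp X ξ) = inner ℂ (WithLp.toLp 2 η' : PiLp 2 (fun _ : Fin m => _))
      (matOp (X.map (compressOp V)) (WithLp.toLp 2 ξ')) := by
    rw [inner_matOp, inner_matOp]
    simp only [Matrix.map_apply, inner_compressOp, hη, hξ]
  rw [e, ← hn η η' hη, ← hn ξ ξ' hξ]
  exact (norm_inner_matOp_le _ _ _).trans (mul_le_mul_of_nonneg_right (h r V) (by positivity))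

theorem matOp_smul {ι : Type} [Fintype ι] (c : ℂ) (X : Matrix ι ι (H →L[ℂ] H)) :
    matOp (c • X) = c • matOp X := by
  ext ξ i
  simp [matOp_apply, Finset.smul_sum]

end Compression

/-! ## Matrix norms of operator spaces -/

theorem OpMatrixNorm.norm_nonneg {V : Type u} [AddCommGroup V] [Module ℂ V] (N : OpMatrixNorm V)
    {n : ℕ} (x : Matrix (Fin n) (Fin n) V) : 0 ≤ N.norm n x := by
  obtain ⟨H, _, _, _, J, _, hJ⟩ := N.exists_repr
  rw [hJ]
  exact _root_.norm_nonneg (matOp (x.map J))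

namespace OpSpace

/-- Since the norm of `M_1(E)` is that of `E`, the representing map is isometric, hence continuous,
and commutes with the infinite sums below. -/
theorem exists_isometry (E : OpSpace.{u}) :
    ∃ (H : Type u) (_ : NormedAddCommGroup H) (_ : InnerProductSpace ℂ H)
      (_ : CompleteSpace H) (J : E →ₗᵢ[ℂ] (H →L[ℂ] H)),
      ∀ (n : ℕ) (x : Matrix (Fin n) (Fin n) E), E.mnorm x = ‖matOp (x.map J)‖ := by
  obtain ⟨H, _, _, _, J, _, hJ⟩ := E.matNorm.exists_repr
  refine ⟨H, inferInstance, inferInstance, inferInstance, ⟨J, fun x => ?_⟩, hJ⟩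
  rw [← E.norm_one x, hJ, ← norm_matOp_one]
  rfl

theorem mnorm_nonneg (E : OpSpace.{u}) {n : ℕ} (x : Matrix (Fin n) (Fin n) E) : 0 ≤ E.mnorm x :=
  E.matNorm.norm_nonneg x

theorem mnorm_smul (E : OpSpace.{u}) {n : ℕ} (c : ℂ) (x : Matrix (Fin n) (Fin n) E) :
    E.mnorm (c • x) = ‖c‖ * E.mnorm x := by
  obtain ⟨H, _, _, _, J, hJ⟩ := E.exists_isometry
  rw [hJ, hJ, ← norm_smul, ← matOp_smul]
  congr 2
  ext1 a b
  simp

theorem mnorm_zero (E : OpSpace.{u}) (n : ℕ) :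
    E.mnorm (0 : Matrix (Fin n) (Fin n) E) = 0 := by
  simpa using E.mnorm_smul 0 (0 : Matrix (Fin n) (Fin n) E)

theorem mnorm_one (E : OpSpace.{u}) (x : E) :
    E.mnorm (Matrix.of fun _ _ : Fin 1 => x) = ‖x‖ :=
  E.norm_one x

theorem norm_entry_le (E : OpSpace.{u}) {n : ℕ} (x : Matrix (Fin n) (Fin n) E) (a b : Fin n) :
    ‖x a b‖ ≤ E.mnorm x := by
  obtain ⟨H, _, _, _, J, hJ⟩ := E.exists_isometry
  rw [hJ, ← J.norm_map]
  exact norm_entry_le_matOp (x.map J) a b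

theorem mnorm_eq_zero_iff (E : OpSpace.{u}) {n : ℕ} (x : Matrix (Fin n) (Fin n) E) :
    E.mnorm x = 0 ↔ x = 0 := by
  refine ⟨fun h => ?_, fun h => h ▸ E.mnorm_zero n⟩
  ext1 a b
  exact norm_le_zero_iff.1 (h ▸ E.norm_entry_le x a b)

end OpSpace

/-! ## Maps out of `ℓ_1({S_1^{n_i}})` -/

/-- The map `S_1^k → E` with matrix `x ∈ M_k(E)`. -/
def S1.lift {k : ℕ} {E : OpSpace.{u}} (x : Matrix (Fin k) (Fin k) E) : S1 k →ₗ[ℂ] E where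
  toFun a := ∑ i, ∑ j, (show Matrix _ _ ℂ from a) i j • x i j
  map_add' a b := by
    simp only [← Finset.sum_add_distrib, ← add_smul]
    rfl
  map_smul' c a := by
    simp only [RingHom.id_apply, Finset.smul_sum, smul_smul]
    rfl

theorem S1.lift_apply {k : ℕ} {E : OpSpace.{u}} (x : Matrix (Fin k) (Fin k) E) (a : S1 k) :
    S1.lift x a = ∑ i, ∑ j, (show Matrix _ _ ℂ from a) i j • x i j := rfl

theorem S1.lift_single {k : ℕ} {E : OpSpace.{u}} (x : Matrix (Fin k) (Fin k) E) (a b : Fin k) :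
    S1.lift x (show S1 k from Matrix.single a b 1) = x a b := by
  rw [S1.lift_apply, Finset.sum_eq_single a, Finset.sum_eq_single b]
  · simp
  · intro j _ hj; simp [hj.symm]
  · simp
  · intro j _ hj; simp [hj.symm]
  · simp

/-- By trace duality, `⟨η, J(lift x a) ξ⟩` is the pairing of `a` with the scalar matrix `T = (⟨η,
J(x i j) ξ⟩)`. The bound `‖T‖ ≤ ‖x‖ ‖η‖ ‖ξ‖` comes from `norm_compress_le`. -/
theorem S1.norm_lift_le {k : ℕ} {E : OpSpace.{u}} (x : Matrix (Fin k) (Fin k) E) (a : S1 k) :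
    ‖S1.lift x a‖ ≤ E.mnorm x * ‖a‖ := by
  obtain ⟨H, _, _, _, J, hJ⟩ := E.exists_isometry
  rw [hJ, ← J.norm_map]
  refine norm_le_of_inner_le (by positivity) fun η ξ => ?_
  set T : Mat k := Matrix.toEuclideanCLM (n := Fin k) (𝕜 := ℂ)
    (Matrix.of fun i j => inner ℂ η (J (x i j) ξ)) with hT
  have e : inner ℂ η (J (S1.lift x a) ξ) = S1.pairing k a T := by
    simp [S1.pairing_apply, S1.lift_apply, hT, toEuclideanCLM_entry]
  have hTn : ‖T‖ ≤ ‖matOp (x.map J)‖ * (‖η‖ * ‖ξ‖) := by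
    refine norm_le_of_inner_le (by positivity) fun β α => ?_
    have e2 : inner ℂ β (T α) = inner ℂ η
        ((∑ s, ∑ t, (starRingEnd ℂ (β s) * α t) • x.map J s t) ξ) := by
      rw [PiLp.inner_apply]
      simp only [sum_apply, smul_apply, inner_sum, inner_smul_right]
      refine Finset.sum_congr rfl fun s _ => ?_
      rw [hT, Matrix.ofLp_toEuclideanCLM, Matrix.mulVec, dotProduct]
      simp only [Matrix.of_apply, RCLike.inner_apply, Finset.sum_mul, Matrix.map_apply]
      exact Finset.sum_congr rfl fun t _ => by ring
    rw [e2]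
    calc _ ≤ ‖η‖ * (‖β‖ * ‖α‖ * ‖matOp (x.map J)‖ * ‖ξ‖) :=
          (norm_inner_le_norm _ _).trans (mul_le_mul_of_nonneg_left
            ((ContinuousLinearMap.le_opNorm _ _).trans (mul_le_mul_of_nonneg_right
              (norm_compress_le (x.map J) β α) (norm_nonneg _))) (norm_nonneg _))
      _ = _ := by ring
  rw [e]
  calc _ ≤ ‖a‖ * ‖T‖ := S1.norm_pairing_le a T
    _ ≤ ‖a‖ * (‖matOp (x.map J)‖ * (‖η‖ * ‖ξ‖)) := mul_le_mul_of_nonneg_left hTn (norm_nonneg _)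
    _ = _ := by ring

section L1Lift

variable {I : Type u} {n : I → ℕ} {E : OpSpace.{u}}

theorem summable_lift {x : ∀ i, Matrix (Fin (n i)) (Fin (n i)) E} {C : ℝ}
    (hx : ∀ i, E.mnorm (x i) ≤ C) (z : lp (fun i => S1 (n i)) 1) :
    Summable fun i => S1.lift (x i) (z i) :=
  Summable.of_norm_bounded ((l1_hasSum n z).summable.mul_left C) fun i =>
    (S1.norm_lift_le _ _).trans (mul_le_mul_of_nonneg_right (hx i) (norm_nonneg _))

/-- The map `ℓ_1({S_1^{n_i}}) → E` given by a bounded family `x_i ∈ M_{n_i}(E)`. -/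
def l1Lift (x : ∀ i, Matrix (Fin (n i)) (Fin (n i)) E) (C : ℝ) (hx : ∀ i, E.mnorm (x i) ≤ C) :
    lp (fun i => S1 (n i)) 1 →ₗ[ℂ] E where
  toFun z := ∑' i, S1.lift (x i) (z i)
  map_add' z w := by
    rw [← (summable_lift hx z).tsum_add (summable_lift hx w)]
    simp
  map_smul' c z := by
    rw [RingHom.id_apply, ← tsum_const_smul'' c]
    simp

theorem l1Lift_apply {x : ∀ i, Matrix (Fin (n i)) (Fin (n i)) E} {C : ℝ}
    (hx : ∀ i, E.mnorm (x i) ≤ C) (z : lp (fun i => S1 (n i)) 1) :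
    l1Lift x C hx z = ∑' i, S1.lift (x i) (z i) := rfl

/-- The matrix units of the summand `S_1^{n_i}`, as a matrix over `ℓ_1({S_1^{n_i}})`. -/
def l1Unit [DecidableEq I] (n : I → ℕ) (i : I) :
    Matrix (Fin (n i)) (Fin (n i)) (lp (fun i => S1 (n i)) 1) :=
  Matrix.of fun a b => lp.single 1 i (show S1 (n i) from Matrix.single a b 1)

theorem l1Lift_unit [DecidableEq I] {x : ∀ i, Matrix (Fin (n i)) (Fin (n i)) E} {C : ℝ}
    (hx : ∀ i, E.mnorm (x i) ≤ C) (i : I) : (l1Unit n i).map (l1Lift x C hx) = x i := by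
  ext1 a b
  rw [Matrix.map_apply, l1Lift_apply, tsum_eq_single i]
  · rw [l1Unit, Matrix.of_apply, lp.single_apply_self, S1.lift_single]
  · intro j hj
    rw [l1Unit, Matrix.of_apply, lp.single_apply_ne _ _ _ hj, map_zero]

theorem norm_pairMat_le_l1MatNorm {m : ℕ} (z : Matrix (Fin m) (Fin m) (lp (fun i => S1 (n i)) 1))
    {r : ℕ} (y : UnitBall n r) : ‖matOp (z.map (pairMat n y))‖ ≤ l1MatNorm n m z := by
  -- A real supremum is meaningful only for bounded families; the sum of the norms of the entries is
  -- a bound uniform in `r` and `y`.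
  refine le_ciSup (f := fun j : Σ r : ℕ, UnitBall n r => ‖matOp (z.map (pairMat n j.2))‖)
    ⟨∑ k, ∑ l, ‖z k l‖, ?_⟩ ⟨r, y⟩
  rintro _ ⟨j, rfl⟩
  exact (norm_matOp_le_sum _).trans
    (Finset.sum_le_sum fun k _ => Finset.sum_le_sum fun l _ => norm_pairMat_le n j.2 (z k l))

/-- Pairing the matrix units of the `i`-th summand with `y` only reads off the entries of `y i`,
with the two pairs of indices exchanged, so `norm_coeffMat_le` with the identity isometry applies.
-/
theorem l1MatNorm_unit_le [DecidableEq I] (i : I) : l1MatNorm n (n i) (l1Unit n i) ≤ 1 := by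
  refine ciSup_le fun ⟨r, y⟩ => ?_
  have e : (l1Unit n i).map (pairMat n y) = coeffMat LinearIsometry.id (y.1 i) := by
    ext1 a b
    rw [Matrix.map_apply, pairMat, coeffMat, Matrix.of_apply]
    congr 1
    ext1 s t
    rw [Matrix.of_apply, Matrix.of_apply, tsum_eq_single i]
    · rw [l1Unit, Matrix.of_apply, lp.single_apply_self, S1.pairing_apply,
        Finset.sum_eq_single a, Finset.sum_eq_single b]
      · simp [Mat.entry, EuclideanSpace.inner_single_left]
      · intro j _ hj; simp [hj.symm]
      · simp
      · intro j _ hj; simp [hj.symm]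
      · simp
    · intro j hj
      rw [l1Unit, Matrix.of_apply, lp.single_apply_ne _ _ _ hj, map_zero, zero_apply]
  show ‖matOp ((l1Unit n i).map (pairMat n y))‖ ≤ 1
  rw [e]
  exact (norm_coeffMat_le _ _).trans (y.2 i)

/-- Along each compression `V`, the image of `z` is `C` times the pairing of `z` with one element of
the unit ball, built from the compressed matrices of the `x i`. -/
theorem mnorm_l1Lift_le {x : ∀ i, Matrix (Fin (n i)) (Fin (n i)) E} {C : ℝ} (hC : 0 < C)
    (hx : ∀ i, E.mnorm (x i) ≤ C) {m : ℕ}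
    (z : Matrix (Fin m) (Fin m) (lp (fun i => S1 (n i)) 1)) :
    E.mnorm (z.map (l1Lift x C hx)) ≤ C * l1MatNorm n m z := by
  obtain ⟨H, _, _, _, J, hJ⟩ := E.exists_isometry
  have h0 : 0 ≤ l1MatNorm n m z := (l1S1 n).matNorm.norm_nonneg z
  rw [hJ]
  refine norm_matOp_le_of_compress _ (by positivity) fun r V => ?_
  -- Dividing by `C` puts the compressed family into the unit ball; this is where `0 < C` is needed.
  let y : UnitBall n r := ⟨fun i => ((C⁻¹ : ℝ) : ℂ) • coeffMat V ((x i).map J), fun i => by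
    rw [matOp_smul, norm_smul, Complex.norm_real, Real.norm_of_nonneg (by positivity),
      inv_mul_le_iff₀ hC, mul_one]
    exact (norm_coeffMat_le _ _).trans ((hJ _ _).symm.trans_le (hx i))⟩
  have e : ((z.map (l1Lift x C hx)).map J).map (compressOp V)
      = (C : ℂ) • z.map (pairMat n y) := by
    ext1 k l
    rw [Matrix.map_apply, Matrix.map_apply, Matrix.map_apply, Matrix.smul_apply, Matrix.map_apply,
      compressOp, pairMat, ← map_smul]
    congr 1
    ext1 s t
    rw [Matrix.of_apply, Matrix.smul_apply, Matrix.of_apply, smul_eq_mul, ← tsum_mul_left,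
      l1Lift_apply]
    -- The matrix coefficient is a continuous functional on `E`, so it passes through the series
    -- defining `l1Lift`.
    let L : E →L[ℂ] ℂ := innerSL ℂ (V (EuclideanSpace.single s 1)) ∘L
      ContinuousLinearMap.apply ℂ H (V (EuclideanSpace.single t 1)) ∘L J.toContinuousLinearMap
    have hL : ∀ v, L v = inner ℂ (V (EuclideanSpace.single s 1))
        (J v (V (EuclideanSpace.single t 1))) := fun v => rfl
    rw [← hL, L.map_tsum (summable_lift hx _)]
    refine tsum_congr fun i => ?_
    show _ = (C : ℂ) * S1.pairing (n i) (z k l i) (((C⁻¹ : ℝ) : ℂ) • coeffMat V ((x i).map J) s t)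
    rw [map_smul, smul_eq_mul, ← mul_assoc, ← Complex.ofReal_mul, mul_inv_cancel₀ hC.ne',
      Complex.ofReal_one, one_mul, S1.pairing_apply, S1.lift_apply]
    simp only [map_sum, map_smul, coeffMat_entry, hL, Matrix.map_apply, sum_apply, smul_apply,
      inner_sum, inner_smul_right]
  rw [e, matOp_smul, norm_smul, Complex.norm_real, Real.norm_of_nonneg hC.le]
  exact mul_le_mul_of_nonneg_left (norm_pairMat_le_l1MatNorm z y) hC.le

end L1Lift

/-! ## Completely bounded maps and complete quotients -/

section Quotient

variable {E F G : OpSpace.{u}}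

theorem IsCB.exists_bound {T : E →ₗ[ℂ] F} (hT : IsCB T) :
    ∃ C : ℝ, 0 ≤ C ∧ ∀ (n : ℕ) (x : Matrix (Fin n) (Fin n) E),
      F.mnorm (x.map T) ≤ C * E.mnorm x := by
  obtain ⟨C, hC⟩ := hT
  exact ⟨|C|, abs_nonneg C, fun n x => (hC n x).trans
    (mul_le_mul_of_nonneg_right (le_abs_self C) (E.mnorm_nonneg x))⟩

/-- No boundedness of `T` is required: the real infimum of the empty set is 0. -/
theorem cbNorm_nonneg (T : E →ₗ[ℂ] F) : 0 ≤ cbNorm T :=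
  Real.sInf_nonneg fun _ h => h.1

theorem cbNorm_le {T : E →ₗ[ℂ] F} {C : ℝ} (hC : 0 ≤ C)
    (h : ∀ (n : ℕ) (x : Matrix (Fin n) (Fin n) E), F.mnorm (x.map T) ≤ C * E.mnorm x) :
    cbNorm T ≤ C :=
  csInf_le ⟨0, fun _ h => h.1⟩ ⟨hC, h⟩

theorem IsCB.mnorm_map_le {T : E →ₗ[ℂ] F} (hT : IsCB T) {n : ℕ} (x : Matrix (Fin n) (Fin n) E) :
    F.mnorm (x.map T) ≤ cbNorm T * E.mnorm x := by
  obtain ⟨C, hC⟩ := hT.exists_bound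
  rcases (E.mnorm_nonneg x).eq_or_lt with h0 | h0
  · rw [← h0, mul_zero]
    simpa [← h0] using hC.2 n x
  · rw [← div_le_iff₀ h0]
    exact le_csInf ⟨C, hC⟩ fun D hD => (div_le_iff₀ h0).2 (hD.2 n x)

theorem IsCB.comp {S : F →ₗ[ℂ] G} {T : E →ₗ[ℂ] F} (hS : IsCB S) (hT : IsCB T) :
    IsCB (S ∘ₗ T) :=
  ⟨cbNorm S * cbNorm T, fun n x => by
    rw [mul_assoc]
    exact (hS.mnorm_map_le (x.map T)).trans
      (mul_le_mul_of_nonneg_left (hT.mnorm_map_le x) (cbNorm_nonneg S))⟩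

theorem isCB_id : IsCB (LinearMap.id : E →ₗ[ℂ] E) :=
  ⟨1, fun n x => by rw [one_mul]; exact le_of_eq rfl⟩

theorem cbNorm_id_le : cbNorm (LinearMap.id : E →ₗ[ℂ] E) ≤ 1 :=
  cbNorm_le zero_le_one fun n x => by rw [one_mul]; exact le_of_eq rfl

theorem IsCB.exists_continuousLinearMap {T : E →ₗ[ℂ] F} (hT : IsCB T) :
    ∃ L : E →L[ℂ] F, (L : E →ₗ[ℂ] F) = T :=
  ⟨T.mkContinuous (cbNorm T) fun x => by
    rw [← E.mnorm_one, ← F.mnorm_one]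
    exact hT.mnorm_map_le (Matrix.of fun _ _ : Fin 1 => x), rfl⟩

/-- The quotient infimum need not be attained, so lifts are available only for norms strictly below
a prescribed bound. -/
theorem isCompleteQuotient_iff {Q : G →ₗ[ℂ] E} :
    IsCompleteQuotient Q ↔ Function.Surjective Q ∧
      (∀ (n : ℕ) (z : Matrix (Fin n) (Fin n) G), E.mnorm (z.map Q) ≤ G.mnorm z) ∧
      ∀ (n : ℕ) (x : Matrix (Fin n) (Fin n) E) (c : ℝ), E.mnorm x < c →
        ∃ z : Matrix (Fin n) (Fin n) G, z.map Q = x ∧ G.mnorm z < c := by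
  have hb : ∀ (n : ℕ) (x : Matrix (Fin n) (Fin n) E), BddBelow
      {c : ℝ | ∃ z : Matrix (Fin n) (Fin n) G, z.map Q = x ∧ c = G.mnorm z} := fun n x =>
    ⟨0, by rintro _ ⟨z, _, rfl⟩; exact G.mnorm_nonneg z⟩
  have hne : Function.Surjective Q → ∀ (n : ℕ) (x : Matrix (Fin n) (Fin n) E),
      {c : ℝ | ∃ z : Matrix (Fin n) (Fin n) G, z.map Q = x ∧ c = G.mnorm z}.Nonempty := by
    intro hQ n x
    choose g hg using hQ
    refine ⟨_, x.map g, ?_, rfl⟩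
    ext1 a b
    exact hg (x a b)
  constructor
  · rintro ⟨hs, h⟩
    refine ⟨hs, fun n z => ?_, fun n x c hc => ?_⟩
    · rw [h]
      exact csInf_le (hb n _) ⟨z, rfl, rfl⟩
    · rw [h] at hc
      obtain ⟨_, ⟨z, hz, rfl⟩, hlt⟩ := exists_lt_of_csInf_lt (hne hs n x) hc
      exact ⟨z, hz, hlt⟩
  · rintro ⟨hs, hle, hl⟩
    refine ⟨hs, fun n x => le_antisymm (le_csInf (hne hs n x) ?_) (le_of_forall_gt fun c hc => ?_)⟩
    · rintro _ ⟨z, rfl, rfl⟩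
      exact hle n z
    · obtain ⟨z, hz, hlt⟩ := hl n x c hc
      exact (csInf_le (hb n x) ⟨z, hz, rfl⟩).trans_lt hlt

namespace IsCompleteQuotient

variable {Q : G →ₗ[ℂ] E}

theorem mnorm_map_le (hQ : IsCompleteQuotient Q) {n : ℕ} (z : Matrix (Fin n) (Fin n) G) :
    E.mnorm (z.map Q) ≤ G.mnorm z :=
  (isCompleteQuotient_iff.1 hQ).2.1 n z

theorem exists_lift (hQ : IsCompleteQuotient Q) {n : ℕ} (x : Matrix (Fin n) (Fin n) E) {c : ℝ}
    (hc : E.mnorm x < c) : ∃ z : Matrix (Fin n) (Fin n) G, z.map Q = x ∧ G.mnorm z < c :=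
  (isCompleteQuotient_iff.1 hQ).2.2 n x c hc

theorem isCB (hQ : IsCompleteQuotient Q) : IsCB Q :=
  ⟨1, fun _ z => by rw [one_mul]; exact hQ.mnorm_map_le z⟩

theorem comp {Z : OpSpace.{u}} {P : Z →ₗ[ℂ] G} (hQ : IsCompleteQuotient Q)
    (hP : IsCompleteQuotient P) : IsCompleteQuotient (Q ∘ₗ P) := by
  refine isCompleteQuotient_iff.2 ⟨hQ.1.comp hP.1, fun n z => ?_, fun n x c hc => ?_⟩
  · exact (hQ.mnorm_map_le (z.map P)).trans (hP.mnorm_map_le z)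
  · obtain ⟨y, rfl, hy⟩ := hQ.exists_lift x hc
    obtain ⟨z, rfl, hz⟩ := hP.exists_lift y hy
    exact ⟨z, rfl, hz⟩

/-- Lifts of norm below `d` exist for every `d` above `‖x‖`; the estimate follows as `d` decreases
to `‖x‖`. -/
theorem le_mul_mnorm (hQ : IsCompleteQuotient Q) {n : ℕ} (x : Matrix (Fin n) (Fin n) E)
    {a C : ℝ} (hC : 0 ≤ C)
    (h : ∀ z : Matrix (Fin n) (Fin n) G, z.map Q = x → a ≤ C * G.mnorm z) :
    a ≤ C * E.mnorm x := by
  have ht : Filter.Tendsto (fun d => C * d) (nhdsWithin (E.mnorm x) (Set.Ioi (E.mnorm x)))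
      (nhds (C * E.mnorm x)) :=
    (Continuous.tendsto (by fun_prop) _).mono_left nhdsWithin_le_nhds
  refine ge_of_tendsto ht (Filter.eventually_of_mem self_mem_nhdsWithin fun d hd => ?_)
  obtain ⟨z, hzx, hz⟩ := hQ.exists_lift x hd
  exact (h z hzx).trans (mul_le_mul_of_nonneg_left hz.le hC)

theorem isCB_of_comp (hQ : IsCompleteQuotient Q) {T : E →ₗ[ℂ] F} (hT : IsCB (T ∘ₗ Q)) :
    IsCB T := by
  obtain ⟨C, hC, h⟩ := hT.exists_bound
  exact ⟨C, fun n x => hQ.le_mul_mnorm x hC fun z hz => hz ▸ h n z⟩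

/-- The admissible constants for `T` and for `T Q` are the same, so the infima agree even if no such
constant exists. -/
theorem cbMatNorm_comp (hQ : IsCompleteQuotient Q) {n : ℕ}
    (T : Matrix (Fin n) (Fin n) (E →ₗ[ℂ] F)) :
    cbMatNorm (T.map fun t => t ∘ₗ Q) = cbMatNorm T := by
  unfold cbMatNorm
  congr 1
  ext C
  refine and_congr_right fun hC => ⟨fun h m x => ?_, fun h m z => ?_⟩
  · exact hQ.le_mul_mnorm x hC fun z hz => hz ▸ h m z
  · exact (h m (z.map Q)).trans (mul_le_mul_of_nonneg_left (hQ.mnorm_map_le z) hC)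

/-- Maps from `ℓ_1({S_1^{n_i}})` lift along complete quotients. -/
theorem exists_l1_lift (hQ : IsCompleteQuotient Q) {I : Type u} {n : I → ℕ}
    (R : l1S1 n →ₗ[ℂ] E) {C D : ℝ} (hC : 0 ≤ C) (hCD : C < D)
    (hR : ∀ (m : ℕ) (z : Matrix (Fin m) (Fin m) (l1S1 n)),
      E.mnorm (z.map R) ≤ C * (l1S1 n).mnorm z) :
    ∃ R' : l1S1 n →ₗ[ℂ] G, Q ∘ₗ R' = R ∧ ∀ (m : ℕ) (z : Matrix (Fin m) (Fin m) (l1S1 n)),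
      G.mnorm (z.map R') ≤ D * (l1S1 n).mnorm z := by
  classical
  -- The strict inequality `C < D` leaves room for the almost optimal lifts `g i` of the images of
  -- the matrix units.
  have hlt : ∀ i, E.mnorm ((l1Unit n i).map R) < D := fun i =>
    ((hR _ (l1Unit n i)).trans (mul_le_of_le_one_right hC (l1MatNorm_unit_le i))).trans_lt hCD
  choose g hg hgD using fun i => hQ.exists_lift _ (hlt i)
  let R' : l1S1 n →ₗ[ℂ] G := l1Lift g D fun i => (hgD i).le
  have hR' : ∀ (m : ℕ) (z : Matrix (Fin m) (Fin m) (l1S1 n)),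
      G.mnorm (z.map R') ≤ D * (l1S1 n).mnorm z :=
    fun m z => mnorm_l1Lift_le (hC.trans_lt hCD) (fun i => (hgD i).le) z
  refine ⟨R', ?_, hR'⟩
  obtain ⟨L₁, hL₁⟩ := (hQ.isCB.comp ⟨D, hR'⟩).exists_continuousLinearMap
  obtain ⟨L₂, hL₂⟩ := IsCB.exists_continuousLinearMap ⟨C, hR⟩
  rw [← hL₁, ← hL₂]
  congr 1
  -- Continuous maps on an `ℓ_1` sum are determined by their restrictions to the summands, and each
  -- `S_1^{n_i}` is spanned by its matrix units.
  refine lp.ext_continuousLinearMap (E := fun i => S1 (n i)) (p := 1) (by norm_num) fun i => ?_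
  have hab : ∀ a b, L₁ (l1Unit n i a b) = L₂ (l1Unit n i a b) := fun a b => by
    have h1 : L₁ (l1Unit n i a b) = Q (((l1Unit n i).map (l1Lift g D fun i => (hgD i).le)) a b) :=
      DFunLike.congr_fun hL₁ _
    have h2 : L₂ (l1Unit n i a b) = R (l1Unit n i a b) := DFunLike.congr_fun hL₂ _
    rw [h1, h2, l1Lift_unit]
    exact congrFun (congrFun (hg i) a) b
  ext s
  have hs : s = ∑ a, ∑ b, (show Matrix _ _ ℂ from s) a b •
      (show S1 (n i) from Matrix.single a b 1) := by
    refine (Matrix.matrix_eq_sum_single (show Matrix _ _ ℂ from s)).trans ?_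
    refine Finset.sum_congr rfl fun a _ => Finset.sum_congr rfl fun b _ => ?_
    rw [← mul_one ((show Matrix _ _ ℂ from s) a b), ← smul_eq_mul, ← Matrix.smul_single]
    simp only [smul_eq_mul, mul_one]
    rfl
  rw [hs]
  simp only [map_sum]
  refine Finset.sum_congr rfl fun a _ => Finset.sum_congr rfl fun b _ => ?_
  refine (map_smul _ _ (show S1 (n i) from _)).trans 
    (.trans ?_ (map_smul _ _ (show S1 (n i) from _)).symm)
  exact congrArg (fun w => (show Matrix _ _ ℂ from s) a b • w) (hab a b)

end IsCompleteQuotient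

/-- Every operator space is a complete quotient of some `ℓ_1({S_1^{n_i}})`. -/
theorem exists_isCompleteQuotient_l1S1 (E : OpSpace.{u}) :
    ∃ (I : Type u) (n : I → ℕ) (Q : l1S1 n →ₗ[ℂ] E), (∀ i, 0 < n i) ∧ IsCompleteQuotient Q := by
  classical
  -- The family consists of all matrices of norm at most 1; size `k + 1` ensures `n_i ≥ 1`.
  let I : Type u := Σ k : ℕ, {x : Matrix (Fin (k + 1)) (Fin (k + 1)) E // E.mnorm x ≤ 1}
  let n : I → ℕ := fun i => i.1 + 1
  have hx : ∀ i : I, E.mnorm (n := n i) i.2.1 ≤ 1 := fun i => i.2.2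
  let Q : l1S1 n →ₗ[ℂ] E := l1Lift (n := n) (fun i => i.2.1) 1 hx
  have hlift : ∀ (k : ℕ) (x : Matrix (Fin k) (Fin k) E),
      ∃ z : Matrix (Fin k) (Fin k) (l1S1 n), z.map Q = x ∧ (l1S1 n).mnorm z ≤ E.mnorm x := by
    -- Size 0 has no index in the family, and `x = 0` cannot be normalised. Otherwise `x / ‖x‖` is
    -- itself an index, and its matrix units scaled by `‖x‖` give a lift without loss of norm.
    rintro (_ | k) x
    · refine ⟨0, Subsingleton.elim _ _, ?_⟩
      rw [OpSpace.mnorm_zero]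
      exact E.mnorm_nonneg x
    rcases (E.mnorm_nonneg x).eq_or_lt with h0 | h0
    · refine ⟨0, ?_, ?_⟩
      · rw [(E.mnorm_eq_zero_iff x).1 h0.symm]
        ext1 a b
        exact map_zero Q
      · rw [OpSpace.mnorm_zero]
        exact E.mnorm_nonneg x
    let i : I := ⟨k, ((E.mnorm x)⁻¹ : ℂ) • x, by
      rw [OpSpace.mnorm_smul, norm_inv, Complex.norm_real, Real.norm_of_nonneg h0.le,
        inv_mul_cancel₀ h0.ne']⟩
    let e : Matrix (Fin (k + 1)) (Fin (k + 1)) (l1S1 n) := l1Unit n i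
    have he : e.map Q = ((E.mnorm x)⁻¹ : ℂ) • x := l1Lift_unit hx i
    refine ⟨(E.mnorm x : ℂ) • e, ?_, ?_⟩
    · have : ((E.mnorm x : ℂ) • e).map Q = (E.mnorm x : ℂ) • e.map Q := by
        ext1 a b
        exact map_smul Q _ _
      rw [this, he, smul_smul, mul_inv_cancel₀ (by exact_mod_cast h0.ne'), one_smul]
    · rw [OpSpace.mnorm_smul, Complex.norm_real, Real.norm_of_nonneg h0.le]
      exact mul_le_of_le_one_right h0.le (l1MatNorm_unit_le (n := n) i)
  refine ⟨I, n, Q, fun i => Nat.succ_pos _, isCompleteQuotient_iff.2 ⟨fun x => ?_, fun k z => ?_,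
    fun k x c hc => ?_⟩⟩
  · obtain ⟨z, hz, -⟩ := hlift 1 (Matrix.of fun _ _ => x)
    exact ⟨z 0 0, congrFun (congrFun hz 0) 0⟩
  · have h : E.mnorm (z.map Q) ≤ 1 * (l1S1 n).mnorm z := mnorm_l1Lift_le zero_lt_one hx z
    rwa [one_mul] at h
  · obtain ⟨z, hz, hle⟩ := hlift k x
    exact ⟨z, hz, hle.trans_lt hc⟩

end Quotient

/-! ## The surjective hull -/

namespace MappingIdeal

variable (A : MappingIdeal.{u}) {E F F₀ G : OpSpace.{u}}

theorem mnorm_nonneg {n : ℕ} (T : Matrix (Fin n) (Fin n) (E →ₗ[ℂ] F))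
    (hT : ∀ i j, T i j ∈ A.space E F) : 0 ≤ A.mnorm T hT :=
  (A.matNorm E F).norm_nonneg _

/-! ### Ideal norms of composites with maps from `ℓ_1` sums -/

section Lift

variable {Q : G →ₗ[ℂ] E} {I : Type u} {n : I → ℕ} {s : F →ₗ[ℂ] F₀}
  {R : l1S1 n →ₗ[ℂ] E}

/-- With a lift `R = Q R'`, the composite equals `s (T Q) R'`, and the ideal property applies to `T
Q`. -/
theorem comp_mem_of_isCompleteQuotient (hQ : IsCompleteQuotient Q) (hs : IsCB s) (hR : IsCB R)
    {T : E →ₗ[ℂ] F} (hT : T ∘ₗ Q ∈ A.space G F) : s ∘ₗ T ∘ₗ R ∈ A.space (l1S1 n) F₀ := by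
  obtain ⟨R', rfl, hR'⟩ := hQ.exists_l1_lift R (cbNorm_nonneg R) (lt_add_one _)
    fun m z => hR.mnorm_map_le z
  exact A.comp_mem (T := T ∘ₗ Q) (r := R') hs hT ⟨_, hR'⟩

theorem mnorm_comp_le_of_isCompleteQuotient (hQ : IsCompleteQuotient Q) (hs : IsCB s)
    (hR : IsCB R) {m : ℕ} (T : Matrix (Fin m) (Fin m) (E →ₗ[ℂ] F))
    (hT : ∀ i j, (T.map fun t => t ∘ₗ Q) i j ∈ A.space G F)
    (hT' : ∀ i j, (T.map fun t => s ∘ₗ t ∘ₗ R) i j ∈ A.space (l1S1 n) F₀) :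
    A.mnorm (T.map fun t => s ∘ₗ t ∘ₗ R) hT' ≤
      cbNorm s * A.mnorm (T.map fun t => t ∘ₗ Q) hT * cbNorm R := by
  have h0 : 0 ≤ cbNorm s * A.mnorm (T.map fun t => t ∘ₗ Q) hT :=
    mul_nonneg (cbNorm_nonneg s) (A.mnorm_nonneg _ hT)
  have ht : Filter.Tendsto (fun D => cbNorm s * A.mnorm (T.map fun t => t ∘ₗ Q) hT * D)
      (nhdsWithin (cbNorm R) (Set.Ioi (cbNorm R)))
      (nhds (cbNorm s * A.mnorm (T.map fun t => t ∘ₗ Q) hT * cbNorm R)) :=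
    (Continuous.tendsto (by fun_prop) _).mono_left nhdsWithin_le_nhds
  -- The lift of `R` has cb norm at most `D` for any given `D` above `cbNorm R`; letting `D`
  -- decrease removes the excess.
  refine ge_of_tendsto ht (Filter.eventually_of_mem self_mem_nhdsWithin fun D hD => ?_)
  obtain ⟨R', hRR', hR'⟩ := hQ.exists_l1_lift R (cbNorm_nonneg R) hD fun m z => hR.mnorm_map_le z
  have hD0 : 0 ≤ D := (cbNorm_nonneg R).trans hD.le
  subst hRR'
  exact (A.norm_comp_le hs (Matrix.of fun i j => ⟨_, hT i j⟩) ⟨D, hR'⟩).trans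
    (mul_le_mul_of_nonneg_left (cbNorm_le hD0 hR') h0)

theorem comp_mem_l1 (hQ : IsCompleteQuotient Q) (hR : IsCB R)
    {T : E →ₗ[ℂ] F} (hT : T ∘ₗ Q ∈ A.space G F) : T ∘ₗ R ∈ A.space (l1S1 n) F :=
  A.comp_mem_of_isCompleteQuotient hQ isCB_id hR hT

theorem mnorm_comp_l1_le (hQ : IsCompleteQuotient Q) (hR : IsCB R) (hR1 : cbNorm R ≤ 1) {m : ℕ}
    (T : Matrix (Fin m) (Fin m) (E →ₗ[ℂ] F))
    (hT : ∀ i j, (T.map fun t => t ∘ₗ Q) i j ∈ A.space G F)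
    (hT' : ∀ i j, (T.map fun t => t ∘ₗ R) i j ∈ A.space (l1S1 n) F) :
    A.mnorm (T.map fun t => t ∘ₗ R) hT' ≤ A.mnorm (T.map fun t => t ∘ₗ Q) hT := by
  refine (A.mnorm_comp_le_of_isCompleteQuotient hQ isCB_id hR T hT hT').trans ?_
  have h0 := A.mnorm_nonneg _ hT
  refine (mul_le_of_le_one_right (mul_nonneg (cbNorm_nonneg _) h0) hR1).trans ?_
  exact mul_le_of_le_one_left h0 cbNorm_id_le

end Lift

end MappingIdeal

theorem IsCompleteQuotient.cbNorm_le_one {E G : OpSpace.{u}} {Q : G →ₗ[ℂ] E}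
    (hQ : IsCompleteQuotient Q) : cbNorm Q ≤ 1 :=
  cbNorm_le zero_le_one fun n z => by rw [one_mul]; exact hQ.mnorm_map_le z

/-! ### A fixed cover of each operator space -/

namespace OpSpace

/-- The index set of a chosen space `Z_E = ℓ_1({S_1^{n_i}})` with a complete quotient map to `E`. -/
def coverIndex (E : OpSpace.{u}) : Type u := (exists_isCompleteQuotient_l1S1 E).choose

/-- The sizes `n_i` of the summands of `Z_E`. -/
def coverSize (E : OpSpace.{u}) : E.coverIndex → ℕ :=
  (exists_isCompleteQuotient_l1S1 E).choose_spec.choose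

/-- The complete quotient map `Q_E : Z_E → E`. -/
def coverMap (E : OpSpace.{u}) : l1S1 E.coverSize →ₗ[ℂ] E :=
  (exists_isCompleteQuotient_l1S1 E).choose_spec.choose_spec.choose

theorem isCompleteQuotient_coverMap (E : OpSpace.{u}) : IsCompleteQuotient E.coverMap :=
  (exists_isCompleteQuotient_l1S1 E).choose_spec.choose_spec.choose_spec.2

end OpSpace

/-- An operator space matrix norm pulls back along an injective linear map. -/
def OpMatrixNorm.comap {V W : Type u} [AddCommGroup V] [Module ℂ V] [AddCommGroup W] [Module ℂ W]
    (N : OpMatrixNorm W) (f : V →ₗ[ℂ] W) (hf : Function.Injective f) : OpMatrixNorm V where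
  norm n x := N.norm n (x.map f)
  exists_repr := by
    obtain ⟨H, _, _, _, J, hJ, hN⟩ := N.exists_repr
    exact ⟨H, _, _, inferInstance, J ∘ₗ f, hJ.comp hf, fun n x => hN n (x.map f)⟩

/-! ### Construction and minimality of the hull -/

namespace MappingIdeal

variable (A : MappingIdeal.{u}) {E F G : OpSpace.{u}}

/-- The space of all `T : E → F` with `T Q_E ∈ 𝒜(Z_E, F)`. -/
def hullSpace (E F : OpSpace.{u}) : Submodule ℂ (E →ₗ[ℂ] F) :=
  (A.space (l1S1 E.coverSize) F).comap (E.coverMap.lcomp ℂ F)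

/-- The map `T ↦ T Q_E`. -/
def hullMap (E F : OpSpace.{u}) : A.hullSpace E F →ₗ[ℂ] A.space (l1S1 E.coverSize) F :=
  (E.coverMap.lcomp ℂ F).restrict fun _ h => h

theorem hullMap_injective (E F : OpSpace.{u}) : Function.Injective (A.hullMap E F) := by
  intro S T h
  ext1
  exact LinearMap.cancel_right (E.isCompleteQuotient_coverMap.1) |>.1 (congrArg Subtype.val h)

/-- The surjective hull of a mapping ideal. -/
def surjectiveHull : MappingIdeal.{u} where
  space := A.hullSpace
  matNorm E F := (A.matNorm _ F).comap (A.hullMap E F) (A.hullMap_injective E F)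
  -- Complete boundedness need not be imposed in `hullSpace`: it descends from `T Q_E` to `T`.
  isCB_of_mem {E _ _} hT := E.isCompleteQuotient_coverMap.isCB_of_comp (A.isCB_of_mem hT)
  cbMatNorm_le {E F n} T := by
    rw [← E.isCompleteQuotient_coverMap.cbMatNorm_comp]
    exact A.cbMatNorm_le (T.map (A.hullMap E F))
  -- The map `r Q_{E₀}` starts from an `ℓ_1` sum, so it lifts along `Q_E`.
  comp_mem {E₀ E F F₀ s T r} hs hT hr :=
    A.comp_mem_of_isCompleteQuotient E.isCompleteQuotient_coverMap hs
      (hr.comp E₀.isCompleteQuotient_coverMap.isCB) hT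
  norm_comp_le {E₀ E F F₀ s r n} hs T hr := by
    have hrQ := hr.comp E₀.isCompleteQuotient_coverMap.isCB
    have hT : ∀ i j, ((T.map Subtype.val).map fun t => t ∘ₗ E.coverMap) i j ∈
        A.space (l1S1 E.coverSize) F := fun i j => (T i j).2
    refine (A.mnorm_comp_le_of_isCompleteQuotient E.isCompleteQuotient_coverMap hs hrQ
      (T.map Subtype.val) hT fun i j => A.comp_mem_of_isCompleteQuotient
        E.isCompleteQuotient_coverMap hs hrQ (T i j).2).trans ?_
    refine mul_le_mul_of_nonneg_left ?_ (mul_nonneg (cbNorm_nonneg s) (A.mnorm_nonneg _ hT))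
    refine cbNorm_le (cbNorm_nonneg r) fun m z => (hr.mnorm_map_le _).trans ?_
    exact mul_le_mul_of_nonneg_left (E₀.isCompleteQuotient_coverMap.mnorm_map_le z)
      (cbNorm_nonneg r)

theorem mem_surjectiveHull_iff {I : Type u} {n : I → ℕ} {Q : l1S1 n →ₗ[ℂ] E}
    (hQ : IsCompleteQuotient Q) {T : E →ₗ[ℂ] F} :
    T ∈ A.surjectiveHull.space E F ↔ T ∘ₗ Q ∈ A.space (l1S1 n) F :=
  ⟨fun h => A.comp_mem_l1 E.isCompleteQuotient_coverMap hQ.isCB h,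
    fun h => A.comp_mem_l1 hQ E.isCompleteQuotient_coverMap.isCB h⟩

/-- Each of `Q` and `Q_E` is at once a complete quotient and a complete contraction from an `ℓ_1`
sum, so the comparison runs in both directions. -/
theorem mnorm_surjectiveHull_eq {I : Type u} {n : I → ℕ} {Q : l1S1 n →ₗ[ℂ] E}
    (hQ : IsCompleteQuotient Q) {m : ℕ} (T : Matrix (Fin m) (Fin m) (E →ₗ[ℂ] F))
    (hT : ∀ i j, T i j ∈ A.surjectiveHull.space E F)
    (hTQ : ∀ i j, (T.map fun t => t ∘ₗ Q) i j ∈ A.space (l1S1 n) F) :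
    A.surjectiveHull.mnorm T hT = A.mnorm (T.map fun t => t ∘ₗ Q) hTQ :=
  le_antisymm
    (A.mnorm_comp_l1_le hQ E.isCompleteQuotient_coverMap.isCB
      E.isCompleteQuotient_coverMap.cbNorm_le_one T hTQ hT)
    (A.mnorm_comp_l1_le E.isCompleteQuotient_coverMap hQ.isCB hQ.cbNorm_le_one T hT hTQ)

theorem isSurjective_surjectiveHull : A.surjectiveHull.IsSurjective := by
  intro G E F Q hQ
  have hQG := hQ.comp G.isCompleteQuotient_coverMap
  refine ⟨fun T _ hTQ => (A.mem_surjectiveHull_iff hQG).2 hTQ, fun m T hT hTQ => ?_⟩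
  -- By definition the hull norm of `T Q` is the `A`-norm of `T Q Q_G`, so this is independence of
  -- the cover for `Q Q_G`.
  exact A.mnorm_surjectiveHull_eq hQG T hT hTQ

theorem contained_surjectiveHull : A.Contained A.surjectiveHull := by
  intro E F
  have hQ := E.isCompleteQuotient_coverMap
  have hmem : ∀ T : E →ₗ[ℂ] F, T ∈ A.space E F → T ∈ A.surjectiveHull.space E F :=
    fun T hT => A.comp_mem isCB_id hT hQ.isCB
  refine ⟨hmem, fun m T hA hB => ?_⟩
  have h0 := A.mnorm_nonneg T hA
  refine (A.norm_comp_le isCB_id (Matrix.of fun i j => ⟨T i j, hA i j⟩) hQ.isCB).trans ?_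
  refine (mul_le_of_le_one_right (mul_nonneg (cbNorm_nonneg _) h0) hQ.cbNorm_le_one).trans ?_
  exact mul_le_of_le_one_left h0 cbNorm_id_le

theorem surjectiveHull_contained {B : MappingIdeal.{u}} (hB : B.IsSurjective)
    (hAB : A.Contained B) : A.surjectiveHull.Contained B := by
  intro E F
  obtain ⟨hmem, hnorm⟩ := hB _ _ F _ E.isCompleteQuotient_coverMap
  obtain ⟨hmem', hnorm'⟩ := hAB (l1S1 E.coverSize) F
  refine ⟨fun T hT => hmem T (A.surjectiveHull.isCB_of_mem hT) (hmem' _ hT), fun m T hA hT => ?_⟩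
  have hTQ : ∀ i j, (T.map fun t => t ∘ₗ E.coverMap) i j ∈ B.space (l1S1 E.coverSize) F :=
    fun i j => hmem' _ (hA i j)
  rw [hnorm m T hT hTQ]
  exact hnorm' m _ hA hTQ

theorem isSurjectiveHull_surjectiveHull : A.IsSurjectiveHull A.surjectiveHull :=
  ⟨A.isSurjective_surjectiveHull, A.contained_surjectiveHull,
    fun _ hB hAB => A.surjectiveHull_contained hB hAB⟩

end MappingIdeal

end

theorem mainTheorem10 (A : MappingIdeal.{u}) :
    -- every operator space is a complete 1-quotient of some `ℓ_1({S_1^{n_i}})`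
    (∀ E : OpSpace.{u}, ∃ (I : Type u) (n : I → ℕ) (Q : l1S1 n →ₗ[ℂ] E),
      (∀ i, 0 < n i) ∧ IsCompleteQuotient Q) ∧
    -- the surjective hull exists
    (∃ H : MappingIdeal.{u}, A.IsSurjectiveHull H) ∧
    -- and it has the stated description, for every choice of such a quotient
    ∀ H : MappingIdeal.{u}, A.IsSurjectiveHull H →
      ∀ (E F : OpSpace.{u}) (I : Type u) (n : I → ℕ) (Q : l1S1 n →ₗ[ℂ] E), IsCompleteQuotient Q →
        (∀ T : E →ₗ[ℂ] F, T ∈ H.space E F ↔ IsCB T ∧ T ∘ₗ Q ∈ A.space (l1S1 n) F) ∧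
        ∀ (m : ℕ) (T : Matrix (Fin m) (Fin m) (E →ₗ[ℂ] F)) (hT : ∀ i j, T i j ∈ H.space E F)
          (hTQ : ∀ i j, (T.map fun t => t ∘ₗ Q) i j ∈ A.space (l1S1 n) F),
          H.mnorm T hT = A.mnorm (T.map fun t => t ∘ₗ Q) hTQ := by
  refine ⟨exists_isCompleteQuotient_l1S1, ⟨_, A.isSurjectiveHull_surjectiveHull⟩, ?_⟩
  rintro H ⟨hH, hAH, hmin⟩ E F I n Q hQ
  -- An arbitrary hull `H` and the constructed one contain each other, so memberships and norms
  -- transfer.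
  obtain ⟨hle, hle'⟩ := A.surjectiveHull_contained hH hAH E F
  obtain ⟨hge, hge'⟩ := hmin _ A.isSurjective_surjectiveHull A.contained_surjectiveHull E F
  refine ⟨fun T => ⟨fun h => ⟨H.isCB_of_mem h, (A.mem_surjectiveHull_iff hQ).1 (hge T h)⟩,
    fun h => hle T ((A.mem_surjectiveHull_iff hQ).2 h.2)⟩, fun m T hT hTQ => ?_⟩
  have hT' : ∀ i j, T i j ∈ A.surjectiveHull.space E F := fun i j => hge _ (hT i j)
  rw [← A.mnorm_surjectiveHull_eq hQ T hT' hTQ]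
  exact le_antisymm (hle' m T hT' hT) (hge' m T hT hT')
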